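/- **Setting.** There are $n\ge 2$ parties in a synchronous network with private pairwise channels; an arbitrary set of parties is corrupted by an active adversary. Party $i$ holds a message $x_i\in\mathbb Z_q$, where $q=O(n^3)$ is prime. Quorums $Q_1,\dots,Q_n$, each of $N=O(\log n)$ parties, have been agreed upon in a one-time setup phase. The shuffling circuit is a comparator network $C$ on $n$ wires of depth $O(\log n)$ (such as the sorting circuit of Leighton and Plaxton); its $i$-th gate is assigned to the quorum $Q_{i\bmod n}$. Values are secret-shared in a quorum by Shamir's scheme with polynomials of degree $\lfloor N/3\rfloor$, using eVSS, the verifiable secret sharing scheme of Kate et al. based on polynomial commitments in a group of order $q$ with a pairing, whose elements are encoded by $O(\kappa)$ bits, where $\kappa$ is the security parameter. **The anonymous broadcast protocol.** 1. *Input sharing.* Each party shares its message by eVSS in the quorum of the input gate on its wire. 2. *Random generation.* Each such quorum generates a shared random $r_i\in\mathbb Z_q$ (GenRand: every member shares a random element by eVSS, and the shares are added). 3. *Circuit computation.* Level by level, the quorum of each gate with inputs $(r,x),(r',x')$ computes a sharing of $\rho=[r\le r']$ by the comparison protocol of Nishide and Ohta (Compare), and then sharings of $s=\rho r+(1-\rho)r'$,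 $y=\rho x+(1-\rho)x'$, $s'=\rho r'+(1-\rho)r$, $y'=\rho x'+(1-\rho)x$ by Beaver's multiplication with random triples (Multiply; the triple is made by two runs of GenRand with degree $\lfloor N/6\rfloor$, local multiplication and share renewal). It renews the shares of the four results (every member shares $0$ by eVSS, and the shares are added) and forwards them to the quorum that works on the wire next. 4. *Output propagation.* The output quorums reconstruct the messages on their wires (every member sends its share to all members, who decode by the method of Berlekamp and Welch), and their members send them to all $n$ parties, who filter by majority. **Cost measures.** Each value sent over a private channel is one message; a broadcast to a quorum of $N$ parties takes one round and counts as $N$ messages. An arithmetic operation on elements of $\mathbb Z_q$ counts as $O(\log q)$ operations, a square root in $\mathbb Z_q$ as $O(\log^2 q)$ arithmetic operations, and a group operation, an exponentiation, a pairing or an equality test in the groups as $O(\kappa+\log q)$ operations, i.e. linearly in the length of its operands. **Lemma.** For every behaviour of the corrupted parties and all outcomes of the random coins, steps 1–3, which shuffle the $n$ messages, send $O(n\log^5 n)$ messages and compute $O\big(n(\kappa+\log n)\log^5 n\big)$ operations. All messages of the protocol (steps 1–4) have size $O(\kappa+\log n)$, and the protocol (steps 1–4) has $O(\log n)$ rounds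 of communication. The implied constants depend only on the constants in $q=O(n^3)$, $N=O(\log n)$, in the depth $O(\log n)$ of $C$, and in the $O(\kappa)$ bits of a group element. -/

import Mathlib

namespace AnonBroadcast

/-! ## Synchronous executions and what they cost -/

/-- A point-to-point message: who sent it, who received it, and its length in bits. -/
structure Message (n : ℕ) where
  sender : Fin n
  receiver : Fin n
  bits : ℕ

/-- What an execution leaves behind: the messages sent, the number of elementary operations
computed by all parties together, and the number of rounds of communication. -/
structure Trace (n : ℕ) where
  msgs : List (Message n)
  ops : ℕ
  rounds : ℕ

/-- One execution after the other. -/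
def Trace.seq {n : ℕ} (a b : Trace n) : Trace n :=
  ⟨a.msgs ++ b.msgs, a.ops + b.ops, a.rounds + b.rounds⟩

/-- Two executions side by side: they share their rounds. -/
def Trace.par {n : ℕ} (a b : Trace n) : Trace n :=
  ⟨a.msgs ++ b.msgs, a.ops + b.ops, max a.rounds b.rounds⟩

/-- The outcome of an execution. `next` counts the entries of the tapes (random coins, messages of
corrupted parties) consumed so far. -/
structure Run (n : ℕ) (α : Type) where
  val : α
  next : ℕ
  trace : Trace n

/-- A protocol among `n` parties with (joint) result in `α`. -/
def Proto (n : ℕ) (α : Type) : Type := ℕ → Run n α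

instance (n : ℕ) : Monad (Proto n) where
  pure a := fun t => ⟨a, t, ⟨[], 0, 0⟩⟩
  bind p f := fun t =>
    let a := p t
    let c := f a.val a.next
    ⟨c.val, c.next, a.trace.seq c.trace⟩

/-- Run a family of protocols in parallel. -/
def par {n : ℕ} {α : Type} : {k : ℕ} → (Fin k → Proto n α) → Proto n (Fin k → α)
  | 0, _ => pure Fin.elim0
  | k + 1, f => fun t =>
    let a := f 0 t
    let c := par (k := k) (fun i => f i.succ) a.next
    ⟨Fin.cons a.val c.val, c.next, a.trace.par c.trace⟩

/-- Run one protocol for each member of a list, all in parallel. -/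
def parList {n : ℕ} {α β : Type} (f : α → Proto n β) : List α → Proto n (List β)
  | [] => pure []
  | x :: l => fun t =>
    let a := f x t
    let c := parList f l a.next
    ⟨a.val :: c.val, c.next, a.trace.par c.trace⟩

/-- A local computation with value `a` that takes `c` elementary operations. -/
def tick {n : ℕ} {α : Type} (c : ℕ) (a : α) : Proto n α := fun t => ⟨a, t, ⟨[], c, 0⟩⟩

/-! ## Arithmetic in the field

An arithmetic operation is charged with the bit length of its operands; `q.size` is the number of
binary digits of `q`. -/

section Field

variable {n q : ℕ}

def fadd (x y : ZMod q) : Proto n (ZMod q) := tick q.size (x + y)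
def fsub (x y : ZMod q) : Proto n (ZMod q) := tick q.size (x - y)
def fmul (x y : ZMod q) : Proto n (ZMod q) := tick q.size (x * y)
def finv (x : ZMod q) : Proto n (ZMod q) := tick q.size x⁻¹
def feq (x y : ZMod q) : Proto n Bool := tick q.size (decide (x = y))

/-- The least square root of `x` (0 if there is none), charged as `4 * q.size ^ 2` field
operations, enough for the algorithm of Tonelli and Shanks. -/
def fsqrt (x : ZMod q) : Proto n (ZMod q) :=
  tick (4 * q.size ^ 2 * q.size)
    (Nat.cast (((List.range q).find? fun r : ℕ => decide ((r : ZMod q) * (r : ZMod q) = x)).getD 0))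

/-- The `i`-th binary digit of the standard representative of `x`. -/
def fbit (x : ZMod q) (i : ℕ) : Proto n Bool := tick q.size (x.val.testBit i)

def fsum : List (ZMod q) → Proto n (ZMod q)
  | [] => pure 0
  | x :: l => do
    let s ← fsum l
    fadd x s

/-- The products `x * l₀`, `x * l₀ * l₁`, … -/
def fscan (x : ZMod q) : List (ZMod q) → Proto n (List (ZMod q))
  | [] => pure []
  | y :: l => do
    let z ← fmul x y
    let r ← fscan z l
    pure (z :: r)

/-! Polynomials are lists of coefficients, constant term first. -/

/-- Horner's rule for the polynomial `p` at `x`, all intermediate values kept: the head of the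
result is `p(x)` and its tail is the quotient `(p - p(x)) / (X - x)`. -/
def hornerTable (x : ZMod q) : List (ZMod q) → Proto n (List (ZMod q))
  | [] => pure []
  | a :: p => do
    let r ← hornerTable x p
    let m ← fmul x (r.headD 0)
    let h ← fadd a m
    pure (h :: r)

def polyEval (p : List (ZMod q)) (x : ZMod q) : Proto n (ZMod q) := do
  let h ← hornerTable x p
  pure (h.headD 0)

/-- `p + c * r`. -/
def polyAxpy (c : ZMod q) : List (ZMod q) → List (ZMod q) → Proto n (List (ZMod q))
  | p, [] => pure p
  | [], b :: r => do
    let m ← fmul c b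
    let s ← polyAxpy c [] r
    pure (m :: s)
  | a :: p, b :: r => do
    let m ← fmul c b
    let h ← fadd a m
    let s ← polyAxpy c p r
    pure (h :: s)

/-- `(X - x) * p`. -/
def polyMulLin (x : ZMod q) (p : List (ZMod q)) : Proto n (List (ZMod q)) := do
  let y ← fsub 0 x
  polyAxpy y (0 :: p) p

/-- Incremental interpolation: `p` interpolates the points already treated and `m` is the product
of `X - x` over their abscissae. -/
def interpolateAux : List (ZMod q × ZMod q) → List (ZMod q) → List (ZMod q) →
    Proto n (List (ZMod q))
  | [], p, _ => pure p
  | (x, y) :: pts, p, m => do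
    let px ← polyEval p x
    let mx ← polyEval m x
    let e ← fsub y px
    let i ← finv mx
    let c ← fmul e i
    let p' ← polyAxpy c p m
    let m' ← polyMulLin x m
    interpolateAux pts p' m'

/-- The interpolation polynomial through the given points. -/
def interpolate (pts : List (ZMod q × ZMod q)) : Proto n (List (ZMod q)) :=
  interpolateAux pts [] [1]

/-- The points whose ordinate differs from the value of `p`. -/
def outliers (p : List (ZMod q)) : List (ZMod q × ZMod q) → Proto n (List (ZMod q × ZMod q))
  | [] => pure []
  | (x, y) :: pts => do
    let v ← polyEval p x
    let ok ← feq v y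
    let r ← outliers p pts
    pure (if ok then r else (x, y) :: r)

/-- A bivariate polynomial `A(X) + B(X) Y` with its weighted degree. -/
structure Key (q : ℕ) where
  A : List (ZMod q)
  B : List (ZMod q)
  weight : ℕ

/-- The value of a key at a point. -/
def Key.disc (k : Key q) (x y : ZMod q) : Proto n (ZMod q) := do
  let a ← polyEval k.A x
  let c ← polyEval k.B x
  let m ← fmul c y
  fadd a m

/-- One step of the algorithm of Berlekamp and Welch: `k` is the pivot, `l` the other key. -/
def Key.step (x dk dl : ZMod q) (k l : Key q) : Proto n (Key q × Key q) := do
  let i ← finv dk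
  let r ← fmul dl i
  let c ← fsub 0 r
  let lA ← polyAxpy c l.A k.A
  let lB ← polyAxpy c l.B k.B
  let kA ← polyMulLin x k.A
  let kB ← polyMulLin x k.B
  pure (⟨kA, kB, k.weight + 1⟩, ⟨lA, lB, l.weight⟩)

/-- Rational interpolation point by point: `k` and `l` vanish at all points already treated and
generate the module of all such `A + B Y`. -/
def berlekampWelchAux : List (ZMod q × ZMod q) → Key q → Key q → Proto n (Key q)
  | [], k, l => pure (if k.weight ≤ l.weight then k else l)
  | (x, y) :: pts, k, l => do
    let dk ← k.disc x y
    let dl ← l.disc x y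
    let zk ← feq dk 0
    let zl ← feq dl 0
    if zk && zl then
      berlekampWelchAux pts k l
    else if !zk && (zl || decide (k.weight ≤ l.weight)) then do
      let r ← Key.step x dk dl k l
      berlekampWelchAux pts r.1 r.2
    else do
      let r ← Key.step x dl dk l k
      berlekampWelchAux pts r.1 r.2

/-- The points that are not roots of `B`. -/
def goodPoints (B : List (ZMod q)) : List (ZMod q × ZMod q) → Proto n (List (ZMod q × ZMod q))
  | [] => pure []
  | (x, y) :: pts => do
    let v ← polyEval B x
    let bad ← feq v 0
    let r ← goodPoints B pts
    pure (if bad then r else (x, y) :: r)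

/-- Decoding of a word with few errors to a polynomial of degree at most `d`: the roots of `B` are
the positions of the errors. -/
def berlekampWelch (d : ℕ) (pts : List (ZMod q × ZMod q)) : Proto n (List (ZMod q)) := do
  let k ← berlekampWelchAux pts ⟨[1], [], 0⟩ ⟨[], [1], d⟩
  let good ← goodPoints k.B pts
  interpolate (good.take (d + 1))

/-- Reconstruction from the shares `a`, the share of the `i`-th party being the value at `i + 1`:
interpolate the first `d + 1` shares, and decode if some share does not fit. The result is the
constant term of the polynomial and the list of shares found to be spurious. -/
def decode {N : ℕ} (d : ℕ) (a : Fin N → ZMod q) :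
    Proto n (ZMod q × List (ZMod q × ZMod q)) := do
  let pts := List.ofFn fun i : Fin N => (((i : ℕ) + 1 : ZMod q), a i)
  let p ← interpolate (pts.take (d + 1))
  let out ← outliers p pts
  if out.isEmpty then
    pure (p.headD 0, [])
  else do
    let p' ← berlekampWelch d pts
    let out' ← outliers p' pts
    pure (p'.headD 0, out')

end Field

/-! ## The network, the adversary and the groups -/

/-- A group `G` of prime order `q` with a generator, a nondegenerate bilinear pairing into `GT`,
and an encoding of the elements of `G` by `b` bits. -/
structure PairingGroup (q b : ℕ) where
  G : Type
  GT : Type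
  [commGroupG : CommGroup G]
  [commGroupGT : CommGroup GT]
  [decEqGT : DecidableEq GT]
  gen : G
  pair : G →* G →* GT
  card_eq : Nat.card G = q
  nondegenerate : pair gen gen ≠ 1
  encode : G ↪ (Fin b → Bool)

attribute [instance] PairingGroup.commGroupG PairingGroup.commGroupGT PairingGroup.decEqGT

/-- Everything that an execution depends on besides the inputs: the group with the trapdoor of its
public key, the corrupted parties, the random coins, and whatever the corrupted parties choose to
send. Every adaptive strategy of the adversary produces some tapes, so that a bound for all tapes
is a bound for all strategies and all coins. -/
structure World (n q b : ℕ) where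
  grp : PairingGroup q b
  trapdoor : ZMod q
  corrupt : Fin n → Bool
  coin : ℕ → ZMod q
  forgeScalar : ℕ → ZMod q
  forgePoint : ℕ → grp.G
  forgeFlag : ℕ → Bool

/-- Data that can be sent: the length of its encoding, and the `t`-th forged value. -/
class Wire {n q b : ℕ} (W : World n q b) (α : Type) where
  bits : ℕ
  forge : ℕ → α

section Network

variable {n q b N : ℕ} (W : World n q b)

instance : Wire W (ZMod q) := ⟨q.size, W.forgeScalar⟩
instance : Wire W W.grp.G := ⟨b, W.forgePoint⟩
instance : Wire W Bool := ⟨1, W.forgeFlag⟩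
instance {α β : Type} [Wire W α] [Wire W β] : Wire W (α × β) :=
  ⟨Wire.bits W α + Wire.bits W β, fun t => (Wire.forge W t, Wire.forge W t)⟩

/-- Send `x` over the private channel from `src` to `dst`: one message, one round. The result is
what `dst` receives. -/
def send {α : Type} [Wire W α] (src dst : Fin n) (x : α) : Proto n α := fun t =>
  ⟨if W.corrupt src then Wire.forge W t else x, t + 1, ⟨[⟨src, dst, Wire.bits W α⟩], 0, 1⟩⟩

/-- Broadcast `x` from `src` to all members of the quorum `Q`: one message to each of them, one
round. The result is what all of them receive. -/
def broadcast {α : Type} [Wire W α] (src : Fin n) (Q : Fin N ↪ Fin n) (x : α) : Proto n α :=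
  fun t =>
    ⟨if W.corrupt src then Wire.forge W t else x, t + 1,
      ⟨List.ofFn fun i => ⟨src, Q i, Wire.bits W α⟩, 0, 1⟩⟩

/-- A fresh random field element. -/
def sample : Proto n (ZMod q) := fun t => ⟨W.coin t, t + 1, ⟨[], q.size, 0⟩⟩

/-- `k` fresh random field elements. -/
def samples : ℕ → Proto n (List (ZMod q))
  | 0 => pure []
  | k + 1 => do
    let x ← sample W
    let l ← samples k
    pure (x :: l)

/-! A group operation, exponentiation or pairing is charged with the bit length of a group element
plus the bit length of an exponent. -/

def gmul {H : Type} [Mul H] (x y : H) : Proto n H := tick (b + q.size) (x * y)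
def ginv {H : Type} [Inv H] (x : H) : Proto n H := tick (b + q.size) x⁻¹
def gpow {H : Type} [Monoid H] (x : H) (e : ZMod q) : Proto n H := tick (b + q.size) (x ^ e.val)
def gpair (x y : W.grp.G) : Proto n W.grp.GT := tick (b + q.size) (W.grp.pair x y)
def geq {H : Type} [DecidableEq H] (x y : H) : Proto n Bool := tick (b + q.size) (decide (x = y))

/-- The public key: `pk j` is the generator to the power `α ^ j`. -/
def pk (j : ℕ) : W.grp.G := W.grp.gen ^ (W.trapdoor ^ j).val

/-! ## The verifiable secret sharing scheme eVSS -/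

/-- The commitment to a polynomial `p`, that is, `pk k ^ p₀ * pk (k + 1) ^ p₁ * ⋯` for `k = 0`. -/
def commitAux (k : ℕ) : List (ZMod q) → Proto n W.grp.G
  | [] => pure 1
  | a :: p => do
    let x ← gpow (n := n) (b := b) (pk W k) a
    let y ← commitAux (k + 1) p
    gmul (q := q) (b := b) x y

def commit (p : List (ZMod q)) : Proto n W.grp.G := commitAux W 0 p

/-- The value of `p` at `x` and its witness, the commitment to `(p - p(x)) / (X - x)`. -/
def openAt (p : List (ZMod q)) (x : ZMod q) : Proto n (ZMod q × W.grp.G) := do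
  let h ← hornerTable x p
  let w ← commit W h.tail
  pure (h.headD 0, w)

/-- Verify that the polynomial committed to by `c` has the value `s.1` at `x`, by the witness
`s.2`: `e(c, g) = e(w, g ^ (α - x)) * e(g, g) ^ s`. -/
def verify (c : W.grp.G) (x : ZMod q) (s : ZMod q × W.grp.G) : Proto n Bool := do
  let l ← gpair W c W.grp.gen
  let gx ← gpow (n := n) (b := b) W.grp.gen x
  let gi ← ginv (q := q) (b := b) gx
  let ga ← gmul (q := q) (b := b) (pk W 1) gi
  let r ← gpair W s.2 ga
  let e ← gpow (n := n) (b := b) (W.grp.pair W.grp.gen W.grp.gen) s.1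
  let r' ← gmul (q := q) (b := b) r e
  geq (q := q) (b := b) l r'

/-- The point of evaluation of the `i`-th member of a quorum. -/
def pt (i : Fin N) : ZMod q := ((i : ℕ) : ZMod q) + 1

/-- The sharing phase of eVSS among the members of `Q` for the polynomial `p`, of degree at most
`d`, of the dealer. The dealer broadcasts the commitment and sends to every member its share with a
witness. Members whose share does not verify accuse the dealer by broadcast. The dealer is
disqualified if there are more than `d` accusations; otherwise it broadcasts the shares of the
accusers, and is disqualified if one of them does not verify. The result is the commitment and,
for every member, its share (`0` if the dealer is disqualified). -/
def vssShare (Q : Fin N ↪ Fin n) (d : ℕ) (dealer : Fin n) (p : List (ZMod q)) :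
    Proto n (W.grp.G × (Fin N → ZMod q)) := do
  let c₀ ← commit W p
  let c ← broadcast W dealer Q c₀
  let dealt ← par fun i : Fin N => openAt W p (pt i)
  let got ← par fun i : Fin N => send W dealer (Q i) (dealt i)
  let accused ← par fun i : Fin N => do
    let ok ← verify W c (pt i) (got i)
    broadcast W (Q i) Q (!ok)
  if d < (List.ofFn accused).count true then
    pure (c, fun _ => 0)
  else do
    let answer ← par fun i : Fin N =>
      if accused i then broadcast W dealer Q (dealt i) else pure (got i)
    par (fun j : Fin N => do
      let oks ← par fun i : Fin N =>
        if accused i then verify W c (pt i) (answer i) else pure true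
      pure (if (List.ofFn oks).all id then (answer j).1 else 0)) >>= fun s => pure (c, s)

/-- Share the secret `s` by a random polynomial of degree at most `d`. -/
def shareSecret (Q : Fin N ↪ Fin n) (d : ℕ) (dealer : Fin n) (s : ZMod q) :
    Proto n (Fin N → ZMod q) := do
  let p ← samples W d
  let r ← vssShare W Q d dealer (s :: p)
  pure r.2

/-- Share `0` by a random polynomial `p` with `p(0) = 0`; the dealer also broadcasts a witness of
`p(0) = 0`, and its sharing counts as `0` if that does not verify. -/
def shareZero (Q : Fin N ↪ Fin n) (d : ℕ) (dealer : Fin n) : Proto n (Fin N → ZMod q) := do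
  let p ← samples W d
  let w₀ ← openAt W (0 :: p) 0
  let r ← vssShare W Q d dealer (0 :: p)
  let w ← broadcast W dealer Q w₀.2
  par fun i : Fin N => do
    let ok ← verify W r.1 0 (0, w)
    pure (if ok then r.2 i else 0)

/-! ## Subprotocols

A shared value is the family of the shares of the members of a quorum. -/

/-- Every member shares a random value, and the shares are added up. -/
def genRand (Q : Fin N ↪ Fin n) (d : ℕ) : Proto n (Fin N → ZMod q) := do
  let s ← par fun j : Fin N => do
    let x ← sample W
    shareSecret W Q d (Q j) x
  par fun i : Fin N => fsum (List.ofFn fun j => s j i)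

/-- Every member shares `0`, and the shares are added to those of the shared value `a`. -/
def renewShares (Q : Fin N ↪ Fin n) (d : ℕ) (a : Fin N → ZMod q) : Proto n (Fin N → ZMod q) := do
  let s ← par fun j : Fin N => shareZero W Q d (Q j)
  par fun i : Fin N => do
    let z ← fsum (List.ofFn fun j => s j i)
    fadd (a i) z

/-- Every member sends its share to all members, and each of them decodes what it receives. The
result is the value that each member obtains. -/
def reconst (Q : Fin N ↪ Fin n) (d : ℕ) (a : Fin N → ZMod q) : Proto n (Fin N → ZMod q) := do
  let m ← par fun j : Fin N => par fun i : Fin N => send W (Q i) (Q j) (a i)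
  par fun j : Fin N => do
    let r ← decode d (m j)
    pure r.1

/-- Linear operations on shared values are local. -/
def shAdd (x y : Fin N → ZMod q) : Proto n (Fin N → ZMod q) := par fun i => fadd (x i) (y i)
def shSub (x y : Fin N → ZMod q) : Proto n (Fin N → ZMod q) := par fun i => fsub (x i) (y i)
def shScale (c : ZMod q) (x : Fin N → ZMod q) : Proto n (Fin N → ZMod q) :=
  par fun i => fmul c (x i)
def shSum {k : ℕ} (x : Fin k → Fin N → ZMod q) : Proto n (Fin N → ZMod q) :=
  par fun i => fsum (List.ofFn fun j => x j i)

/-- Exclusive or of a public bit and a shared bit. -/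
def shXor (c : Fin N → Bool) (x : Fin N → ZMod q) : Proto n (Fin N → ZMod q) :=
  par fun i => if c i then fsub 1 (x i) else pure (x i)

/-- Multiplication of two values shared by polynomials of degree `N / 3`, by means of a random
triple `u, v, w = u * v`. -/
def multiply (Q : Fin N ↪ Fin n) (x y : Fin N → ZMod q) : Proto n (Fin N → ZMod q) := do
  let uv ← par fun _ : Fin 2 => genRand W Q (N / 6)
  let w ← par fun i : Fin N => fmul (uv 0 i) (uv 1 i)
  let r ← par fun k : Fin 3 => renewShares W Q (N / 3) (![uv 0, uv 1, w] k)
  let e ← shAdd x (r 0)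
  let f ← shAdd y (r 1)
  let o ← par fun k : Fin 2 => reconst W Q (N / 3) (![e, f] k)
  par fun i : Fin N => do
    let m₁ ← fmul (o 1 i) (x i)
    let m₂ ← fmul (o 0 i) (y i)
    let m₃ ← fmul (o 0 i) (o 1 i)
    let s₁ ← fadd (r 2 i) m₁
    let s₂ ← fadd s₁ m₂
    fsub s₂ m₃

/-! ## Comparison of shared values, after Nishide and Ohta -/

/-- A random invertible shared value and its inverse. -/
def randInv (Q : Fin N ↪ Fin n) : Proto n ((Fin N → ZMod q) × (Fin N → ZMod q)) := do
  let r ← par fun _ : Fin 2 => genRand W Q (N / 3)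
  let m ← multiply W Q (r 0) (r 1)
  let o ← reconst W Q (N / 3) m
  let i ← par fun j : Fin N => do
    let z ← finv (o j)
    fmul z (r 1 j)
  pure (r 0, i)

/-- The powers `x, x ^ 2, …, x ^ k` of an invertible shared value, in a constant number of
rounds. -/
def powers (Q : Fin N ↪ Fin n) (k : ℕ) (x : Fin N → ZMod q) :
    Proto n (Fin k → Fin N → ZMod q) := do
  let r ← par fun _ : Fin (k + 1) => randInv W Q
  let e ← par fun j : Fin k => do
    let u ← multiply W Q (r j.castSucc).1 x
    let v ← multiply W Q u (r j.succ).2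
    reconst W Q (N / 3) v
  let m ← par fun j : Fin k => multiply W Q (r 0).2 (r j.succ).1
  let s ← par fun i : Fin N => fscan 1 (List.ofFn fun j => e j i)
  par fun j : Fin k => par fun i : Fin N => fmul ((s i).getD j 0) (m j i)

/-- The disjunction of `k` shared bits: the polynomial that maps `1` to `0` and `2, …, k + 1` to
`1`, at one plus the sum of the bits. -/
def disj (Q : Fin N ↪ Fin n) {k : ℕ} (x : Fin k → Fin N → ZMod q) :
    Proto n (Fin N → ZMod q) := do
  let s ← shSum x
  let y ← shAdd (fun _ => 1) s
  let pw ← powers W Q k y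
  par fun i : Fin N => do
    let p ← interpolate
      (List.ofFn fun j : Fin (k + 1) => (((j : ℕ) : ZMod q) + 1, if j = 0 then 0 else 1))
    let terms ← par fun j : Fin k => fmul (p.getD (j + 1) 0) (pw j i)
    let t ← fsum (List.ofFn terms)
    fadd (p.headD 0) t

/-- The disjunctions of all initial segments of `l` shared bits, cut into blocks of about the
square root of `l`. -/
def prefixDisj (Q : Fin N ↪ Fin n) {l : ℕ} (x : Fin l → Fin N → ZMod q) :
    Proto n (Fin l → Fin N → ZMod q) := do
  let k := l.sqrt + 1
  let z : Fin k → Fin k → Fin N → ZMod q := fun i j =>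
    if h : (i : ℕ) * k + j < l then x ⟨i * k + j, h⟩ else fun _ => 0
  let v ← par fun i : Fin k => disj W Q (z i)
  let y ← par fun i : Fin k => disj W Q fun j : Fin k => if j ≤ i then v j else fun _ => 0
  let f ← par fun i : Fin k =>
    shSub (y i) (if (i : ℕ) = 0 then fun _ => 0 else y (i - 1))
  let g ← par fun i : Fin k => par fun j : Fin k => multiply W Q (f i) (z i j)
  let c ← par fun j : Fin k => shSum fun i : Fin k => g i j
  let e ← par fun j : Fin k => disj W Q fun i : Fin k => if i ≤ j then c i else fun _ => 0
  let s ← par fun i : Fin k => par fun j : Fin k => do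
    let m ← multiply W Q (f i) (e j)
    let a ← shAdd m (y i)
    shSub a (f i)
  pure fun m => s
    ⟨m / k, Nat.div_lt_of_lt_mul (m.isLt.trans (Nat.lt_succ_sqrt l))⟩
    ⟨m % k, Nat.mod_lt _ (Nat.succ_pos _)⟩

/-- For a public number and a shared number, both given by their binary digits (digit `i` has
weight `2 ^ i`): the shared indicator of the most significant digit in which they differ. -/
def firstDiff (Q : Fin N ↪ Fin n) {l : ℕ} (c : Fin N → Fin l → Bool)
    (x : Fin l → Fin N → ZMod q) : Proto n (Fin l → Fin N → ZMod q) := do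
  let e ← par fun i : Fin l => shXor (fun p => c p i) (x i)
  let f ← prefixDisj W Q fun i : Fin l => e i.rev
  par fun i : Fin l =>
    shSub (f i.rev) (if h : (i : ℕ) + 1 < l then f (Fin.rev ⟨i + 1, h⟩) else fun _ => 0)

/-- A random shared bit. -/
def randBit (Q : Fin N ↪ Fin n) : Proto n (Fin N → ZMod q) := do
  let x ← genRand W Q (N / 3)
  let y ← multiply W Q x x
  let o ← reconst W Q (N / 3) y
  par fun i : Fin N => do
    let r ← fsqrt (o i)
    let z ← finv r
    let m ← fmul (x i) z
    let p ← fadd m 1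
    let h ← finv 2
    fmul p h

/-- One attempt to generate the digits of a random shared number below `q`: the digits, and for
every member whether the check that the number is below `q` was passed. -/
def randDigitsOnce (Q : Fin N ↪ Fin n) :
    Proto n ((Fin q.size → Fin N → ZMod q) × (Fin N → Bool)) := do
  let x ← par fun _ : Fin q.size => randBit W Q
  let g ← firstDiff W Q (fun _ i => q.testBit i) x
  let s ← shSum fun i : Fin q.size => if q.testBit i then g i else fun _ => 0
  let o ← reconst W Q (N / 3) s
  let ok ← par fun i : Fin N => feq (o i) 1
  pure (x, ok)

/-- The digits of a random shared number below `q`: the first of four parallel attempts that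
passes the check. -/
def randDigits (Q : Fin N ↪ Fin n) : Proto n (Fin q.size → Fin N → ZMod q) := do
  let r ← par fun _ : Fin 4 => randDigitsOnce W Q
  pure fun j i =>
    if (r 0).2 i then (r 0).1 j i
    else if (r 1).2 i then (r 1).1 j i
    else if (r 2).2 i then (r 2).1 j i
    else (r 3).1 j i

/-- The least significant digit of a shared value. -/
def lsb (Q : Fin N ↪ Fin n) (x : Fin N → ZMod q) : Proto n (Fin N → ZMod q) := do
  let dig ← randDigits W Q
  let terms ← par fun j : Fin q.size => shScale (2 ^ (j : ℕ)) (dig j)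
  let r ← shSum terms
  let y ← shAdd x r
  let o ← reconst W Q (N / 3) y
  let c ← par fun i : Fin N => par fun j : Fin q.size => fbit (o i) j
  let c₀ ← par fun i : Fin N => fbit (o i) 0
  let g ← firstDiff W Q c dig
  let h ← par fun j : Fin q.size => multiply W Q (g j) (dig j)
  let f ← shSum h
  let e ← shXor c₀ (if h : 0 < q.size then dig ⟨0, h⟩ else fun _ => 0)
  let m ← multiply W Q e f
  let s ← shAdd e f
  let m₂ ← shScale 2 m
  shSub s m₂

/-- The shared bit that tells whether `x < y`, where field elements are compared by their standard
representatives `0, …, q - 1`: it is determined by the three bits `x < q / 2`, `y < q / 2` and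
`x - y < q / 2`, and `x < q / 2` is the negation of the least significant digit of `2 * x`. -/
def less (Q : Fin N ↪ Fin n) (x y : Fin N → ZMod q) : Proto n (Fin N → ZMod q) := do
  let z ← shSub x y
  let t ← par fun k : Fin 3 => do
    let d ← shScale 2 (![x, y, z] k)
    let l ← lsb W Q d
    shSub (fun _ => 1) l
  let m ← multiply W Q (t 1) (t 2)
  let s ← shAdd (t 1) (t 2)
  let m₂ ← shScale 2 m
  let u ← shSub s m₂
  let v ← multiply W Q (t 0) u
  let a₁ ← shAdd v m
  let a₂ ← shAdd (fun _ => 1) a₁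
  shSub a₂ s

/-- The shared bit that tells whether `x ≤ y`. -/
def compare (Q : Fin N ↪ Fin n) (x y : Fin N → ZMod q) : Proto n (Fin N → ZMod q) := do
  let l ← less W Q y x
  shSub (fun _ => 1) l

end Network

/-! ## The shuffling circuit -/

/-- A network of comparators on `n` wires. It is a list of levels; a level is a list of comparators
on pairwise disjoint pairs of wires. The comparator `(i, j)` puts the lower value on wire `i`.
The protocol evaluates any such circuit; whether it sorts all or most inputs plays no role for the
costs. -/
structure ComparatorNetwork (n : ℕ) where
  levels : List (List (Fin n × Fin n))
  disjoint : ∀ L ∈ levels, (L.flatMap fun g => [g.1, g.2]).Nodup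

def ComparatorNetwork.depth {n : ℕ} (C : ComparatorNetwork n) : ℕ := C.levels.length

/-- A gate: its comparator and its number. -/
abbrev Gate (n : ℕ) : Type := (Fin n × Fin n) × ℕ

/-- Number the gates of the levels consecutively, from `k` on. -/
def numberGates {n : ℕ} : ℕ → List (List (Fin n × Fin n)) → List (List (Gate n))
  | _, [] => []
  | k, L :: Ls => L.zipIdx k :: numberGates (k + L.length) Ls

/-- The quorum that works on wire `w` next: the quorum `i mod n` of the next gate `i` on that wire
or, if there is none, the output quorum of the wire (wires `2 k` and `2 k + 1` share one). -/
def nextQuorum {n : ℕ} (rest : List (List (Gate n))) (w : Fin n) : Fin n :=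
  match rest.flatten.find? fun g => decide (g.1.1 = w) || decide (g.1.2 = w) with
  | some g => ⟨g.2 % n, Nat.mod_lt _ w.pos⟩
  | none => ⟨w / 2, lt_of_le_of_lt (Nat.div_le_self _ _) w.isLt⟩

/-! ## Anonymous broadcast -/

/-- What a wire carries: a shared random number and a shared message. -/
abbrev Pair (N q : ℕ) : Type := (Fin N → ZMod q) × (Fin N → ZMod q)

section Main

variable {n q b N : ℕ} (W : World n q b)

/-- Renew the shares of a value in the quorum `Q` and forward them to the quorum `Q'`. -/
def reshare (Q Q' : Fin N ↪ Fin n) (x : Fin N → ZMod q) : Proto n (Fin N → ZMod q) := do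
  let y ← renewShares W Q (N / 3) x
  par fun i : Fin N => send W (Q i) (Q' i) (y i)

/-- The work of the quorum `Q` on one gate with inputs `u = (r, x)` and `v = (r', x')`: gate
computation, then resharing of the two outputs in the quorums `Q₁` and `Q₂`. -/
def gate (Q Q₁ Q₂ : Fin N ↪ Fin n) (u v : Pair N q) : Proto n (Pair N q × Pair N q) := do
  let ρ ← compare W Q u.1 v.1
  let ρ' ← shSub (fun _ => 1) ρ
  let m ← par fun k : Fin 8 =>
    multiply W Q (![ρ, ρ', ρ, ρ', ρ, ρ', ρ, ρ'] k)
      (![u.1, v.1, u.2, v.2, v.1, u.1, v.2, u.2] k)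
  let s ← par fun k : Fin 4 =>
    shAdd (![m 0, m 2, m 4, m 6] k) (![m 1, m 3, m 5, m 7] k)
  let t ← par fun k : Fin 4 => reshare W Q (![Q₁, Q₁, Q₂, Q₂] k) (s k)
  pure ((t 0, t 1), (t 2, t 3))

/-- Put the outputs of the gates of a level on their wires. -/
def rewire : List (Gate n) → List (Pair N q × Pair N q) → (Fin n → Pair N q) → Fin n → Pair N q
  | g :: gs, o :: os, st =>
    rewire gs os (Function.update (Function.update st g.1.1 o.1) g.1.2 o.2)
  | _, _, st => st

/-- Evaluate the circuit level by level. -/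
def evalLevels (Q : Fin n → Fin N ↪ Fin n) :
    List (List (Gate n)) → (Fin n → Pair N q) → Proto n (Fin n → Pair N q)
  | [], st => pure st
  | L :: rest, st => do
    let outs ← parList (fun g : Gate n =>
      gate W (Q ⟨g.2 % n, Nat.mod_lt _ g.1.1.pos⟩)
        (Q (nextQuorum rest g.1.1)) (Q (nextQuorum rest g.1.2)) (st g.1.1) (st g.1.2)) L
    evalLevels Q rest (rewire L outs st)

/-- The shuffle: input sharing, random generation and circuit computation. Party `i` has the
message `x i` and shares it in the quorum of the input gate on wire `i`. -/
def shuffle (C : ComparatorNetwork n) (Q : Fin n → Fin N ↪ Fin n) (x : Fin n → ZMod q) :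
    Proto n (Fin n → Pair N q) := do
  let gates := numberGates 0 C.levels
  let xs ← par fun i : Fin n => shareSecret W (Q (nextQuorum gates i)) (N / 3) i (x i)
  let rs ← par fun i : Fin n => genRand W (Q (nextQuorum gates i)) (N / 3)
  evalLevels W Q gates fun i => (rs i, xs i)

/-- The member of a list that occurs most often, by comparing all pairs. -/
def majority (l : List (ZMod q × ZMod q)) : Proto n (ZMod q × ZMod q) :=
  tick (l.length ^ 2 * (2 * q.size)) ((l.argmax fun a => l.count a).getD (0, 0))

/-- Output propagation: the `k`-th output quorum reconstructs the messages on wires `2 k` and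
`2 k + 1` (on wire `2 k` twice, if it is the last one), each of its members sends both to all
parties, and these filter by majority. The result is the list of messages that each party gets. -/
def propagate (Q : Fin n → Fin N ↪ Fin n) (st : Fin n → Pair N q) :
    Proto n (Fin n → List (ZMod q)) := do
  let o ← par fun k : Fin ((n + 1) / 2) => do
    let w₁ : Fin n := ⟨2 * k, by omega⟩
    let w₂ : Fin n := if h : 2 * (k : ℕ) + 1 < n then ⟨2 * k + 1, h⟩ else w₁
    let R := Q ⟨k, by omega⟩
    let z ← par fun e : Fin 2 => reconst W R (N / 3) (![(st w₁).2, (st w₂).2] e)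
    par fun p : Fin n => par fun i : Fin N => send W (R i) p (z 0 i, z 1 i)
  par fun p : Fin n => do
    let m ← par fun k : Fin ((n + 1) / 2) => majority (List.ofFn (o k p))
    pure (((List.ofFn m).flatMap fun a => [a.1, a.2]).take n)

/-- The protocol, after the quorums have been set up. -/
def anonymousBroadcast (C : ComparatorNetwork n) (Q : Fin n → Fin N ↪ Fin n)
    (x : Fin n → ZMod q) : Proto n (Fin n → List (ZMod q)) := do
  let st ← shuffle W C Q x
  propagate W Q st

end Main

end AnonBroadcast

namespace AnonBroadcast

/-! ## Cost bounds -/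

/-! The cost of a protocol is bounded by recursion on its program text. Sequential composition adds
messages, operations and rounds; parallel composition adds messages and operations but takes the
maximum of the rounds; a branch costs no more than a common bound for its two sides. None of these
rules looks at the values exchanged, so every bound holds for all coins and all forged messages. The
only feature of the data on which costs depend is the length of coefficient lists, and the
postcondition in `Bounded` carries exactly that.

Let `M` bound the quorum size, the bit length of `q` and, at the end, the depth, and let `G` bound
the cost of a group operation. One run of eVSS costs `O(M ^ 2)` messages: each of up to `M`
accusations, and each answer to one, is a broadcast to `M` members. `genRand` and `renewShares` let
every member deal, hence `M ^ 3`, and `multiply` stays at that order. A disjunction of `k` bits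
costs `O(k * M ^ 3)` messages. `prefixDisj` cuts the digits of a field element into `k ≈ √M` blocks,
which gives `k ^ 2 * M ^ 3`, that is, `O(M ^ 4)`; comparison and a whole gate stay at that order. A
level has at most `n` gates and there are at most `M` levels: `O(n * M ^ 5)` in total. Operations
follow the same pattern with an additional factor `G`, local decoding and interpolation being
absorbed. A gate takes a constant number of rounds, so the rounds are `O(M)`.

Finally `M = O(log n)` by `size_le_mul_log` and the hypotheses, and `G = O(κ + log n)`. -/

/-- Every execution of `p` sends at most `m` messages of at most `B` bits each, computes at most
`c` operations, has at most `r` rounds, and its result satisfies `P`. -/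
def Bounded {n : ℕ} {α : Type} (B : ℕ) (P : α → Prop) (p : Proto n α) (m c r : ℕ) : Prop :=
  ∀ t, (p t).trace.msgs.length ≤ m ∧ (p t).trace.ops ≤ c ∧ (p t).trace.rounds ≤ r ∧
    (∀ μ ∈ (p t).trace.msgs, μ.bits ≤ B) ∧ P (p t).val

/-- A bound for the costs alone. -/
abbrev CostLE {n : ℕ} {α : Type} (B : ℕ) (p : Proto n α) (m c r : ℕ) : Prop :=
  Bounded B (fun _ => True) p m c r

section Calculus

variable {n B : ℕ} {α β : Type} {P : α → Prop} {P' : β → Prop} {m c r m' c' r' : ℕ}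

theorem Bounded.mono {p : Proto n α} {R : α → Prop} (h : Bounded B P p m c r) (hm : m ≤ m')
    (hc : c ≤ c') (hr : r ≤ r') (hP : ∀ a, P a → R a) : Bounded B R p m' c' r' := fun t =>
  let ⟨h₁, h₂, h₃, h₄, h₅⟩ := h t
  ⟨h₁.trans hm, h₂.trans hc, h₃.trans hr, h₄, hP _ h₅⟩

theorem Bounded.le {p : Proto n α} (h : Bounded B P p m c r) (hm : m ≤ m') (hc : c ≤ c')
    (hr : r ≤ r') : Bounded B P p m' c' r' :=
  h.mono hm hc hr fun _ => id

theorem Bounded.costLE {p : Proto n α} (h : Bounded B P p m c r) : CostLE B p m c r :=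
  h.mono le_rfl le_rfl le_rfl fun _ _ => trivial

theorem Bounded.pure {a : α} (h : P a) : Bounded B P (pure a : Proto n α) 0 0 0 := fun _ =>
  ⟨le_rfl, le_rfl, le_rfl, fun _ h => absurd h List.not_mem_nil, h⟩

theorem CostLE.pure {a : α} : CostLE B (pure a : Proto n α) 0 0 0 :=
  Bounded.pure trivial

theorem CostLE.pure_le {a : α} : CostLE B (Pure.pure a : Proto n α) m c r :=
  CostLE.pure.le (Nat.zero_le _) (Nat.zero_le _) (Nat.zero_le _)

/-- The continuation is bounded uniformly over all results satisfying `P`. This is where the actual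
values, and with them the adversary and the coins, are forgotten. -/
theorem Bounded.bind {p : Proto n α} {f : α → Proto n β} (hp : Bounded B P p m c r)
    (hf : ∀ a, P a → Bounded B P' (f a) m' c' r') :
    Bounded B P' (p >>= f) (m + m') (c + c') (r + r') := fun t => by
  obtain ⟨h₁, h₂, h₃, h₄, h₅⟩ := hp t
  obtain ⟨k₁, k₂, k₃, k₄, k₅⟩ := hf _ h₅ (p t).next
  refine ⟨?_, Nat.add_le_add h₂ k₂, Nat.add_le_add h₃ k₃, ?_, k₅⟩
  · exact (List.length_append ..).trans_le (Nat.add_le_add h₁ k₁)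
  · intro μ hμ
    exact (List.mem_append.1 hμ).elim (h₄ μ) (k₄ μ)

theorem Bounded.tick {a : α} (h : P a) : Bounded B P (tick c a : Proto n α) 0 c 0 := fun _ =>
  ⟨le_rfl, le_rfl, le_rfl, fun _ h => absurd h List.not_mem_nil, h⟩

theorem CostLE.tick {a : α} : CostLE B (tick c a : Proto n α) 0 c 0 :=
  Bounded.tick trivial

theorem Bounded.ite {b : Prop} [Decidable b] {p p' : Proto n α} (h : Bounded B P p m c r)
    (h' : Bounded B P p' m c r) : Bounded B P (if b then p else p') m c r := by
  split <;> assumption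

/-- Parallel runs share their rounds, so only messages and operations are multiplied. The separate
bound `K` allows a quorum of size `N` to be counted as `M` right away. -/
theorem CostLE.par {k K : ℕ} (hk : k ≤ K) {f : Fin k → Proto n α}
    (h : ∀ i, CostLE B (f i) m c r) : CostLE B (par f) (K * m) (K * c) r := by
  suffices CostLE B (AnonBroadcast.par f) (k * m) (k * c) r from
    this.le (Nat.mul_le_mul_right _ hk) (Nat.mul_le_mul_right _ hk) le_rfl
  -- The induction on `k` must not carry the bound by the fixed `K`.
  clear hk
  induction k with
  | zero => exact CostLE.pure_le
  | succ k ih =>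
    intro t
    obtain ⟨h₁, h₂, h₃, h₄, -⟩ := h 0 t
    obtain ⟨k₁, k₂, k₃, k₄, -⟩ := ih (f := fun i => f i.succ) (fun i => h i.succ) (f 0 t).next
    refine ⟨?_, ?_, max_le h₃ k₃, ?_, trivial⟩
    · refine (List.length_append ..).trans_le ((Nat.add_le_add h₁ k₁).trans_eq ?_)
      ring
    · exact (Nat.add_le_add h₂ k₂).trans_eq (by ring)
    · intro μ hμ
      exact (List.mem_append.1 hμ).elim (h₄ μ) (k₄ μ)

theorem CostLE.parList {f : α → Proto n β} (h : ∀ a, CostLE B (f a) m c r) :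
    ∀ l : List α, CostLE B (parList f l) (l.length * m) (l.length * c) r
  | [] => CostLE.pure_le
  | a :: l => fun t => by
    obtain ⟨h₁, h₂, h₃, h₄, -⟩ := h a t
    obtain ⟨k₁, k₂, k₃, k₄, -⟩ := CostLE.parList h l (f a t).next
    refine ⟨?_, ?_, max_le h₃ k₃, ?_, trivial⟩
    · refine (List.length_append ..).trans_le ((Nat.add_le_add h₁ k₁).trans_eq ?_)
      rw [List.length_cons]; ring
    · refine (Nat.add_le_add h₂ k₂).trans_eq ?_
      rw [List.length_cons]; ring
    · intro μ hμ
      exact (List.mem_append.1 hμ).elim (h₄ μ) (k₄ μ)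

end Calculus

/-! ## Costs of field arithmetic and decoding -/

section Field

variable {n q B : ℕ}

theorem fadd_cost (x y : ZMod q) : CostLE B (fadd x y : Proto n _) 0 q.size 0 := CostLE.tick
theorem fsub_cost (x y : ZMod q) : CostLE B (fsub x y : Proto n _) 0 q.size 0 := CostLE.tick
theorem fmul_cost (x y : ZMod q) : CostLE B (fmul x y : Proto n _) 0 q.size 0 := CostLE.tick
theorem finv_cost (x : ZMod q) : CostLE B (finv x : Proto n _) 0 q.size 0 := CostLE.tick
theorem feq_cost (x y : ZMod q) : CostLE B (feq x y : Proto n _) 0 q.size 0 := CostLE.tick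
theorem fbit_cost (x : ZMod q) (i : ℕ) : CostLE B (fbit x i : Proto n _) 0 q.size 0 := CostLE.tick
theorem fsqrt_cost (x : ZMod q) :
    CostLE B (fsqrt x : Proto n _) 0 (4 * q.size ^ 2 * q.size) 0 := CostLE.tick

theorem fsum_cost : ∀ l : List (ZMod q), CostLE B (fsum l : Proto n _) 0 (l.length * q.size) 0
  | [] => CostLE.pure_le
  | x :: l => ((fsum_cost l).bind fun s _ => fadd_cost x s).le le_rfl
      (by rw [List.length_cons]; linarith) le_rfl

theorem fscan_cost : ∀ (x : ZMod q) (l : List (ZMod q)),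
    CostLE B (fscan x l : Proto n _) 0 (l.length * q.size) 0
  | _, [] => CostLE.pure_le
  | x, y :: l => ((fmul_cost x y).bind fun z _ => (fscan_cost z l).bind fun _ _ =>
      CostLE.pure).le le_rfl (by rw [List.length_cons]; linarith) le_rfl

theorem hornerTable_bounded (x : ZMod q) : ∀ p : List (ZMod q),
    Bounded B (fun h => h.length = p.length) (hornerTable x p : Proto n _) 0
      (p.length * (2 * q.size)) 0
  | [] => by
    unfold hornerTable
    exact (Bounded.pure (P := fun h : List (ZMod q) => h.length = 0) rfl).le le_rfl (Nat.zero_le _) le_rfl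
  | a :: p => ((hornerTable_bounded x p).bind fun r hr => (fmul_cost x (r.headD 0)).bind
      fun m _ => (fadd_cost a m).bind fun h _ => Bounded.pure (by simp [hr])).le le_rfl
      (by rw [List.length_cons]; linarith) le_rfl

theorem polyEval_cost (p : List (ZMod q)) (x : ZMod q) :
    CostLE B (polyEval p x : Proto n _) 0 (p.length * (2 * q.size)) 0 :=
  (hornerTable_bounded x p).bind fun _ _ => CostLE.pure

/-- Only the scaled list `r` is traversed; the part of `p` beyond it is copied without cost. -/
theorem polyAxpy_bounded (c : ZMod q) : ∀ p r : List (ZMod q),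
    Bounded B (fun h => h.length = max p.length r.length) (polyAxpy c p r : Proto n _) 0
      (r.length * (2 * q.size)) 0
  | [], [] => by
    unfold polyAxpy
    exact (Bounded.pure (by simp)).le le_rfl (Nat.zero_le _) le_rfl
  | _ :: _, [] => by
    unfold polyAxpy
    exact (Bounded.pure (by simp)).le le_rfl (Nat.zero_le _) le_rfl
  | [], b :: r => by
    unfold polyAxpy
    refine ((fmul_cost c b).bind fun m _ => (polyAxpy_bounded c [] r).bind fun s hs =>
      Bounded.pure (by simp [hs])).le le_rfl ?_ le_rfl
    rw [List.length_cons]; linarith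
  | a :: p, b :: r => by
    unfold polyAxpy
    refine ((fmul_cost c b).bind fun m _ => (fadd_cost a m).bind fun h _ =>
      (polyAxpy_bounded c p r).bind fun s hs => Bounded.pure (by simp [hs])).le le_rfl ?_ le_rfl
    rw [List.length_cons]; linarith

theorem polyMulLin_bounded (x : ZMod q) (p : List (ZMod q)) :
    Bounded B (fun h => h.length = p.length + 1) (polyMulLin x p : Proto n _) 0
      ((2 * p.length + 1) * q.size) 0 := by
  refine ((fsub_cost 0 x).bind fun y _ => polyAxpy_bounded y (0 :: p) p).mono le_rfl
    (by linarith) le_rfl fun a ha => ?_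
  rw [ha, List.length_cons]; omega

/-! ### Interpolation and decoding -/

/-- Each point lengthens the product `m` by one and `p` to at most the larger of the two lengths.
Hence length plus number of remaining points never exceeds `T`, and a single point costs at most `8
* T + 4` field operations. -/
theorem interpolateAux_bounded (T : ℕ) : ∀ (pts : List (ZMod q × ZMod q)) (p m : List (ZMod q)),
    p.length + pts.length ≤ T → m.length + pts.length ≤ T →
    Bounded B (fun h => h.length ≤ T) (interpolateAux pts p m : Proto n _) 0
      (pts.length * ((8 * T + 4) * q.size)) 0
  | [], p, m, hp, _ => (Bounded.pure (by simpa using hp)).le le_rfl (Nat.zero_le _) le_rfl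
  | (x, y) :: pts, p, m, hp, hm => by
    rw [List.length_cons] at hp hm
    refine ((polyEval_cost p x).bind fun px _ => (polyEval_cost m x).bind fun mx _ =>
      (fsub_cost y px).bind fun e _ => (finv_cost mx).bind fun i _ => (fmul_cost e i).bind
      fun c _ => (polyAxpy_bounded c p m).bind fun p' hp' => (polyMulLin_bounded x m).bind
      fun m' hm' => interpolateAux_bounded T pts p' m' (by omega) (by omega)).le le_rfl ?_ le_rfl
    have h₁ : p.length * q.size ≤ T * q.size := Nat.mul_le_mul_right _ (by omega)
    have h₂ : m.length * q.size ≤ T * q.size := Nat.mul_le_mul_right _ (by omega)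
    rw [List.length_cons]
    linarith

theorem interpolate_bounded (pts : List (ZMod q × ZMod q)) :
    Bounded B (fun h => h.length ≤ pts.length + 1) (interpolate pts : Proto n _) 0
      (pts.length * ((8 * pts.length + 12) * q.size)) 0 :=
  (interpolateAux_bounded (pts.length + 1) pts [] [1] (by simp) (by simp [add_comm])).le le_rfl
    (by linarith) le_rfl

theorem outliers_cost (p : List (ZMod q)) : ∀ pts : List (ZMod q × ZMod q),
    CostLE B (outliers p pts : Proto n _) 0 (pts.length * ((2 * p.length + 1) * q.size)) 0
  | [] => CostLE.pure_le
  | (x, y) :: pts => by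
    refine ((polyEval_cost p x).bind fun v _ => (feq_cost v y).bind fun ok _ =>
      (outliers_cost p pts).bind fun r _ => CostLE.pure).le le_rfl ?_ le_rfl
    rw [List.length_cons]; linarith

theorem goodPoints_bounded (p : List (ZMod q)) : ∀ pts : List (ZMod q × ZMod q),
    Bounded B (fun h => h.length ≤ pts.length) (goodPoints p pts : Proto n _) 0
      (pts.length * ((2 * p.length + 1) * q.size)) 0
  | [] => by
    unfold goodPoints
    exact (Bounded.pure (Nat.le_refl _)).le le_rfl (Nat.zero_le _) le_rfl
  | (x, y) :: pts => by
    refine ((polyEval_cost p x).bind fun v _ => (feq_cost v 0).bind fun bad _ =>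
      (goodPoints_bounded p pts).bind fun r hr => Bounded.pure ?_).le le_rfl ?_ le_rfl
    · split <;> simp <;> omega
    · rw [List.length_cons]; linarith

/-- Both polynomials of a key have at most `D` coefficients. -/
def Key.SizeLE (k : Key q) (D : ℕ) : Prop := k.A.length ≤ D ∧ k.B.length ≤ D

theorem Key.SizeLE.mono {k : Key q} {D D' : ℕ} (h : k.SizeLE D) (hD : D ≤ D') : k.SizeLE D' :=
  ⟨h.1.trans hD, h.2.trans hD⟩

theorem Key.disc_cost {k : Key q} {D : ℕ} (hk : k.SizeLE D) (x y : ZMod q) :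
    CostLE B (k.disc x y : Proto n _) 0 ((4 * D + 2) * q.size) 0 := by
  refine ((polyEval_cost k.A x).bind fun a _ => (polyEval_cost k.B x).bind fun c _ =>
    (fmul_cost c y).bind fun m _ => fadd_cost a m).le le_rfl ?_ le_rfl
  have h₁ := Nat.mul_le_mul_right q.size hk.1
  have h₂ := Nat.mul_le_mul_right q.size hk.2
  linarith

theorem Key.step_bounded {k l : Key q} {D : ℕ} (hk : k.SizeLE D) (hl : l.SizeLE D)
    (x dk dl : ZMod q) :
    Bounded B (fun r => r.1.SizeLE (D + 1) ∧ r.2.SizeLE (D + 1)) (Key.step x dk dl k l : Proto n _)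
      0 ((8 * D + 5) * q.size) 0 := by
  refine ((finv_cost dk).bind fun i _ => (fmul_cost dl i).bind fun r _ => (fsub_cost 0 r).bind
    fun c _ => (polyAxpy_bounded c l.A k.A).bind fun lA hlA => (polyAxpy_bounded c l.B k.B).bind
    fun lB hlB => (polyMulLin_bounded x k.A).bind fun kA hkA => (polyMulLin_bounded x k.B).bind
    fun kB hkB => Bounded.pure ?_).le le_rfl ?_ le_rfl
  · obtain ⟨hk₁, hk₂⟩ := hk
    obtain ⟨hl₁, hl₂⟩ := hl
    simp only [Key.SizeLE]
    omega
  · have h₁ := Nat.mul_le_mul_right q.size hk.1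
    have h₂ := Nat.mul_le_mul_right q.size hk.2
    linarith

/-- A point lengthens both keys by at most one, so `D + pts.length` does not increase along the
recursion. One point costs two discrepancies, two zero tests and at most one pivot step: `2 * (4 * D
+ 2) + 2 + (8 * D + 5)` field operations. -/
theorem berlekampWelchAux_bounded (T : ℕ) : ∀ (pts : List (ZMod q × ZMod q)) (k l : Key q) (D : ℕ),
    k.SizeLE D → l.SizeLE D → D + pts.length ≤ T →
    Bounded B (fun h => h.SizeLE T) (berlekampWelchAux pts k l : Proto n _) 0
      (pts.length * ((16 * T + 11) * q.size)) 0
  | [], k, l, D, hk, hl, hT => by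
    refine (Bounded.pure ?_).le le_rfl (Nat.zero_le _) le_rfl
    have hT : D ≤ T := by simpa using hT
    split
    exacts [hk.mono hT, hl.mono hT]
  | (x, y) :: pts, k, l, D, hk, hl, hT => by
    rw [List.length_cons] at hT
    have h₁ : D * q.size ≤ T * q.size := Nat.mul_le_mul_right _ (by omega)
    refine ((Key.disc_cost hk x y).bind fun dk _ => (Key.disc_cost hl x y).bind fun dl _ =>
      (feq_cost dk 0).bind fun zk _ => (feq_cost dl 0).bind fun zl _ =>
      -- The common bound of the three branches is a pivot step plus the remaining points; the
      -- branch without a step fits trivially.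
      Bounded.ite (m := 0) (r := 0) (c := (8 * D + 5) * q.size + pts.length * ((16 * T + 11) * q.size)) ?_
        (Bounded.ite ?_ ?_)).le le_rfl ?_ le_rfl
    · exact (berlekampWelchAux_bounded T pts k l D hk hl (by omega)).le le_rfl
        (Nat.le_add_left _ _) le_rfl
    · exact (Key.step_bounded hk hl x dk dl).bind fun r hr =>
        berlekampWelchAux_bounded T pts r.1 r.2 (D + 1) hr.1 hr.2 (by omega)
    · exact (Key.step_bounded hl hk x dl dk).bind fun r hr =>
        berlekampWelchAux_bounded T pts r.1 r.2 (D + 1) hr.1 hr.2 (by omega)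
    · rw [List.length_cons]; linarith

theorem berlekampWelch_bounded (d : ℕ) (pts : List (ZMod q × ZMod q)) :
    Bounded B (fun h => h.length ≤ pts.length + 1) (berlekampWelch d pts : Proto n _) 0
      (pts.length * ((26 * pts.length + 42) * q.size)) 0 := by
  refine ((berlekampWelchAux_bounded (pts.length + 1) pts _ _ 1 ?_ ?_ (by omega)).bind
    (m' := 0) (r' := 0) (c' := pts.length * ((10 * pts.length + 15) * q.size)) fun k hk => ?_).le le_rfl ?_ le_rfl
  · simp [Key.SizeLE]
  · simp [Key.SizeLE]
  · refine ((goodPoints_bounded k.B pts).bind (m' := 0) (r' := 0)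
      (c' := pts.length * ((8 * pts.length + 12) * q.size)) fun good hgood =>
      (interpolate_bounded (good.take (d + 1))).mono le_rfl ?_ le_rfl ?_).le le_rfl ?_ le_rfl
    · have : (good.take (d + 1)).length ≤ pts.length := by simp; omega
      gcongr
    · intro a ha
      simp at ha; omega
    · have : pts.length * ((2 * k.B.length + 1) * q.size) ≤
          pts.length * ((2 * (pts.length + 1) + 1) * q.size) := by
        gcongr; exact hk.2
      linarith
  · linarith

/-- The worst case is that the first interpolation fails: one interpolation, one run of Berlekamp
and Welch and two searches for outliers, all quadratic in `N`. -/
theorem decode_cost {N : ℕ} (d : ℕ) (a : Fin N → ZMod q) :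
    CostLE B (decode d a : Proto n _) 0 (N * ((38 * N + 60) * q.size)) 0 := by
  unfold decode
  extract_lets pts
  have hpts : pts.length = N := by simp [pts]
  have hout : ∀ p : List (ZMod q), p.length ≤ N + 1 →
      CostLE B (outliers p pts : Proto n _) 0 (N * ((2 * N + 3) * q.size)) 0 := fun p hp => by
    refine (outliers_cost p pts).le le_rfl ?_ le_rfl
    rw [hpts]
    exact Nat.mul_le_mul_left _ (Nat.mul_le_mul_right _ (by omega))
  have htake : (pts.take (d + 1)).length ≤ N := by simp [hpts]
  refine (((interpolate_bounded (pts.take (d + 1))).mono le_rfl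
      (c' := N * ((8 * N + 12) * q.size)) (by gcongr) le_rfl (R := fun h => h.length ≤ N + 1)
      (by intro a ha; omega)).bind fun p hp => (hout p hp).bind fun out _ =>
    Bounded.ite CostLE.pure_le (((berlekampWelch_bounded d pts).mono le_rfl
      (c' := N * ((26 * N + 42) * q.size)) (by rw [hpts]) le_rfl (R := fun h => h.length ≤ N + 1)
      (by intro a ha; omega)).bind fun p' hp' => (hout p' hp').bind fun out' _ =>
      CostLE.pure)).le le_rfl ?_ le_rfl
  linarith

end Field

/-! ## Costs of verifiable secret sharing and of the subprotocols

All bounds are polynomials in a bound `M` for the size of a quorum and the length of a field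
element, and a bound `G` for the cost of a group operation. -/

/-- The common bounds for the parameters of the protocol. -/
structure SizeBounds (q b N M G : ℕ) : Prop where
  one_le : 1 ≤ M
  quorum_le : N ≤ M
  size_le : q.size ≤ M
  group_le : b + q.size ≤ G

namespace SizeBounds

variable {n q b N M G : ℕ} (H : SizeBounds q b N M G)
include H

theorem field_le : q.size ≤ G := (Nat.le_add_left _ _).trans H.group_le

theorem pow_le (i : ℕ) {j : ℕ} (h : i ≤ j) : M ^ i ≤ M ^ j := Nat.pow_le_pow_right H.one_le h

theorem pow_mul_le (i : ℕ) {j : ℕ} (h : i ≤ j) : M ^ i * G ≤ M ^ j * G :=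
  Nat.mul_le_mul_right _ (H.pow_le i h)

variable {B : ℕ}

theorem fadd (x y : ZMod q) : CostLE B (fadd x y : Proto n _) 0 G 0 :=
  (fadd_cost x y).le le_rfl H.field_le le_rfl
theorem fsub (x y : ZMod q) : CostLE B (fsub x y : Proto n _) 0 G 0 :=
  (fsub_cost x y).le le_rfl H.field_le le_rfl
theorem fmul (x y : ZMod q) : CostLE B (fmul x y : Proto n _) 0 G 0 :=
  (fmul_cost x y).le le_rfl H.field_le le_rfl
theorem finv (x : ZMod q) : CostLE B (finv x : Proto n _) 0 G 0 :=
  (finv_cost x).le le_rfl H.field_le le_rfl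
theorem feq (x y : ZMod q) : CostLE B (feq x y : Proto n _) 0 G 0 :=
  (feq_cost x y).le le_rfl H.field_le le_rfl
theorem fbit (x : ZMod q) (i : ℕ) : CostLE B (fbit x i : Proto n _) 0 G 0 :=
  (fbit_cost x i).le le_rfl H.field_le le_rfl
theorem fsqrt (x : ZMod q) : CostLE B (fsqrt x : Proto n _) 0 (4 * M ^ 2 * G) 0 :=
  (fsqrt_cost x).le le_rfl
    (Nat.mul_le_mul (Nat.mul_le_mul_left _ (Nat.pow_le_pow_left H.size_le 2)) H.field_le) le_rfl
theorem fsum_ofFn {k K : ℕ} (hk : k ≤ K) (f : Fin k → ZMod q) :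
    CostLE B (fsum (List.ofFn f) : Proto n _) 0 (K * G) 0 :=
  (fsum_cost _).le le_rfl (by rw [List.length_ofFn]; exact Nat.mul_le_mul hk H.field_le) le_rfl
theorem fscan_ofFn {k : ℕ} (x : ZMod q) (f : Fin k → ZMod q) :
    CostLE B (fscan x (List.ofFn f) : Proto n _) 0 (k * G) 0 :=
  (fscan_cost _ _).le le_rfl (by rw [List.length_ofFn]; exact Nat.mul_le_mul_left _ H.field_le)
    le_rfl

theorem decode (d : ℕ) (a : Fin N → ZMod q) :
    CostLE B (decode d a : Proto n _) 0 (98 * M ^ 2 * G) 0 := by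
  refine (decode_cost d a).le le_rfl ?_ le_rfl
  calc N * ((38 * N + 60) * q.size) ≤ M * ((38 * M + 60 * M) * G) := by
        have := H.one_le
        refine Nat.mul_le_mul H.quorum_le (Nat.mul_le_mul ?_ H.field_le)
        have := H.quorum_le
        omega
    _ = 98 * M ^ 2 * G := by ring

variable (W : World n q b)

/-! ### Messages, coins and group operations -/

omit H in
theorem send {α : Type} [Wire W α] (hB : Wire.bits W α ≤ B) (src dst : Fin n) (x : α) :
    CostLE B (send W src dst x) 1 0 1 := fun _ =>
  ⟨le_rfl, le_rfl, le_rfl, fun _ hμ => by rw [List.mem_singleton.1 hμ]; exact hB, trivial⟩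

theorem broadcast {α : Type} [Wire W α] (hB : Wire.bits W α ≤ B) (src : Fin n)
    (Q : Fin N ↪ Fin n) (x : α) : CostLE B (broadcast W src Q x) M 0 1 := fun _ => by
  refine ⟨(List.length_ofFn ..).trans_le H.quorum_le, le_rfl, le_rfl, fun μ hμ => ?_, trivial⟩
  obtain ⟨i, rfl⟩ := List.mem_ofFn.1 hμ
  exact hB

theorem bits_scalar : Wire.bits W (ZMod q) ≤ 2 * G :=
  show q.size ≤ 2 * G from H.field_le.trans (by omega)

theorem bits_group : Wire.bits W W.grp.G ≤ 2 * G :=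
  show b ≤ 2 * G from ((Nat.le_add_right _ _).trans H.group_le).trans (by omega)

theorem bits_share : Wire.bits W (ZMod q × W.grp.G) ≤ 2 * G :=
  show q.size + b ≤ 2 * G by have := H.group_le; omega

/-- This type of message is why the common length bound is `2 * G`: two scalars need not fit into `b
+ q.size` bits when `b` is small. -/
theorem bits_pair : Wire.bits W (ZMod q × ZMod q) ≤ 2 * G :=
  show q.size + q.size ≤ 2 * G by have := H.field_le; omega

theorem bits_flag (hq : 1 ≤ q.size) : Wire.bits W Bool ≤ 2 * G :=
  show 1 ≤ 2 * G by have := H.field_le; omega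

theorem sample : CostLE B (sample W) 0 G 0 := fun _ =>
  ⟨le_rfl, H.field_le, le_rfl, fun _ h => absurd h List.not_mem_nil, trivial⟩

theorem samples : ∀ k, Bounded B (fun l => l.length = k) (samples W k) 0 (k * G) 0
  | 0 => by
    unfold AnonBroadcast.samples
    exact (Bounded.pure (P := fun l : List (ZMod q) => l.length = 0) rfl).le le_rfl
      (Nat.zero_le _) le_rfl
  | k + 1 => (Bounded.bind (H.sample W) fun x _ => (samples k).bind fun l hl =>
      Bounded.pure (by simp [hl])).le le_rfl (by linarith) le_rfl

theorem gmul {K : Type} [Mul K] (x y : K) :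
    CostLE B (gmul (q := q) (b := b) x y : Proto n _) 0 G 0 :=
  CostLE.tick.le le_rfl H.group_le le_rfl
theorem ginv {K : Type} [Inv K] (x : K) :
    CostLE B (ginv (q := q) (b := b) x : Proto n _) 0 G 0 :=
  CostLE.tick.le le_rfl H.group_le le_rfl
theorem gpow {K : Type} [Monoid K] (x : K) (e : ZMod q) :
    CostLE B (gpow (b := b) x e : Proto n _) 0 G 0 :=
  CostLE.tick.le le_rfl H.group_le le_rfl
theorem gpair (x y : W.grp.G) : CostLE B (gpair W x y) 0 G 0 :=
  CostLE.tick.le le_rfl H.group_le le_rfl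
theorem geq {K : Type} [DecidableEq K] (x y : K) :
    CostLE B (geq (q := q) (b := b) x y : Proto n _) 0 G 0 :=
  CostLE.tick.le le_rfl H.group_le le_rfl

/-! ### Verifiable secret sharing -/

theorem commitAux : ∀ (p : List (ZMod q)) (k : ℕ),
    CostLE B (commitAux W k p) 0 (p.length * (2 * G)) 0
  | [], _ => CostLE.pure_le
  | a :: p, k => (Bounded.bind (H.gpow _ _) fun _ _ => (commitAux p (k + 1)).bind fun _ _ =>
      H.gmul _ _).le le_rfl (by rw [List.length_cons]; linarith) le_rfl

theorem commit {D : ℕ} {p : List (ZMod q)} (hp : p.length ≤ D) :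
    CostLE B (commit W p) 0 (D * (2 * G)) 0 :=
  (H.commitAux W p 0).le le_rfl (Nat.mul_le_mul_right _ hp) le_rfl

theorem openAt {D : ℕ} {p : List (ZMod q)} (hp : p.length ≤ D) (x : ZMod q) :
    CostLE B (openAt W p x) 0 (D * (4 * G)) 0 := by
  refine ((hornerTable_bounded x p).bind fun h hh => Bounded.bind (H.commit W (D := D)
    (p := h.tail) ?_) fun w _ => CostLE.pure).le le_rfl ?_ le_rfl
  · rw [List.length_tail]; omega
  · have : p.length * (2 * q.size) ≤ D * (2 * G) :=
      Nat.mul_le_mul hp (Nat.mul_le_mul_left _ H.field_le)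
    linarith

theorem verify (c : W.grp.G) (x : ZMod q) (s : ZMod q × W.grp.G) :
    CostLE B (verify W c x s) 0 (8 * G) 0 :=
  (Bounded.bind (H.gpair W _ _) fun _ _ => Bounded.bind (H.gpow _ _) fun _ _ =>
    Bounded.bind (H.ginv _) fun _ _ => Bounded.bind (H.gmul _ _) fun _ _ =>
    Bounded.bind (H.gpair W _ _) fun _ _ => Bounded.bind (H.gpow _ _) fun _ _ =>
    Bounded.bind (H.gmul _ _) fun _ _ => H.geq _ _).le le_rfl (by linarith) le_rfl

theorem vssShare (hq : 1 ≤ q.size) (Q : Fin N ↪ Fin n) (d : ℕ) (dealer : Fin n)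
    {p : List (ZMod q)} (hp : p.length ≤ 2 * M) :
    CostLE (2 * G) (vssShare W Q d dealer p) (4 * M ^ 2) (28 * M ^ 2 * G) 4 := by
  -- Monomials in `M` and `G` are atoms for `linarith`; these inequalities, which rest on `1 ≤ M`,
  -- lift the lower-order terms to the leading one. The same device recurs in the bounds below.
  have hM := H.pow_le 1 (j := 2) (by norm_num)
  have hG := H.pow_mul_le 1 (j := 2) (by norm_num)
  refine (Bounded.bind (H.commit W hp) fun c₀ _ =>
    Bounded.bind (H.broadcast W (H.bits_group W) _ _ _) fun c _ =>
    Bounded.bind (CostLE.par H.quorum_le fun i => H.openAt W hp _) fun dealt _ =>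
    Bounded.bind (CostLE.par H.quorum_le fun i => send W (H.bits_share W) _ _ _) fun got _ =>
    Bounded.bind (CostLE.par H.quorum_le fun i => Bounded.bind (H.verify W _ _ _) fun ok _ =>
      H.broadcast W (H.bits_flag W hq) _ _ _) fun accused _ =>
    Bounded.ite CostLE.pure_le <|
    -- Worst case: every member has accused the dealer, and each accusation is answered by a
    -- broadcast and verified by all.
    Bounded.bind (CostLE.par H.quorum_le fun i =>
      Bounded.ite (H.broadcast W (H.bits_share W) _ _ _) CostLE.pure_le) fun answer _ =>
    Bounded.bind (CostLE.par H.quorum_le fun j => Bounded.bind (CostLE.par H.quorum_le fun i =>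
      Bounded.ite (H.verify W _ _ _) CostLE.pure_le) fun oks _ => CostLE.pure) fun s _ =>
    CostLE.pure).le ?_ ?_ ?_
  · linarith
  · linarith
  · norm_num

theorem shareSecret (hq : 1 ≤ q.size) (Q : Fin N ↪ Fin n) {d : ℕ} (hd : d ≤ M) (dealer : Fin n)
    (s : ZMod q) :
    CostLE (2 * G) (shareSecret W Q d dealer s) (4 * M ^ 2) (29 * M ^ 2 * G) 4 := by
  have hG := H.pow_mul_le 1 (j := 2) (by norm_num)
  have hdG := Nat.mul_le_mul_right G hd
  have hM := H.one_le
  refine ((H.samples W d).bind fun p hl => Bounded.bind (H.vssShare W hq Q d dealer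
    (p := s :: p) ?_) fun r _ => CostLE.pure).le ?_ ?_ ?_
  -- There are `d + 1` coefficients, and `d + 1 ≤ 2 * M` because `1 ≤ M`.
  · rw [List.length_cons]; omega
  · linarith
  · linarith
  · norm_num

theorem shareZero (hq : 1 ≤ q.size) (Q : Fin N ↪ Fin n) {d : ℕ} (hd : d ≤ M) (dealer : Fin n) :
    CostLE (2 * G) (shareZero W Q d dealer) (5 * M ^ 2) (45 * M ^ 2 * G) 5 := by
  have hM' := H.pow_le 1 (j := 2) (by norm_num)
  have hG := H.pow_mul_le 1 (j := 2) (by norm_num)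
  have hdG := Nat.mul_le_mul_right G hd
  have hM := H.one_le
  have hlen : ∀ p : List (ZMod q), p.length = d → (0 :: p : List (ZMod q)).length ≤ 2 * M :=
    fun p hl => by rw [List.length_cons]; omega
  refine ((H.samples W d).bind fun p hl => Bounded.bind (H.openAt W (hlen p hl) _) fun w₀ _ =>
    Bounded.bind (H.vssShare W hq Q d dealer (hlen p hl)) fun r _ =>
    Bounded.bind (H.broadcast W (H.bits_group W) _ _ _) fun w _ =>
    CostLE.par H.quorum_le fun i => Bounded.bind (H.verify W _ _ _) fun ok _ =>
      CostLE.pure).le ?_ ?_ ?_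
  · linarith
  · linarith
  · norm_num

/-! ### Random generation, renewal, reconstruction and multiplication -/

theorem genRand (hq : 1 ≤ q.size) (Q : Fin N ↪ Fin n) {d : ℕ} (hd : d ≤ M) :
    CostLE (2 * G) (genRand W Q d) (4 * M ^ 3) (31 * M ^ 3 * G) 4 := by
  have h₁ := H.pow_mul_le 1 (j := 3) (by norm_num)
  have h₂ := H.pow_mul_le 2 (j := 3) (by norm_num)
  refine (Bounded.bind (CostLE.par H.quorum_le fun j => Bounded.bind (H.sample W) fun x _ =>
    H.shareSecret W hq Q hd _ _) fun s _ =>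
    CostLE.par H.quorum_le fun i => H.fsum_ofFn H.quorum_le _).le ?_ ?_ ?_
  · linarith
  · linarith
  · norm_num

theorem renewShares (hq : 1 ≤ q.size) (Q : Fin N ↪ Fin n) {d : ℕ} (hd : d ≤ M)
    (a : Fin N → ZMod q) :
    CostLE (2 * G) (renewShares W Q d a) (5 * M ^ 3) (47 * M ^ 3 * G) 5 := by
  have h₁ := H.pow_mul_le 1 (j := 3) (by norm_num)
  have h₂ := H.pow_mul_le 2 (j := 3) (by norm_num)
  refine (Bounded.bind (CostLE.par H.quorum_le fun j => H.shareZero W hq Q hd _) fun s _ =>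
    CostLE.par H.quorum_le fun i => Bounded.bind (H.fsum_ofFn H.quorum_le _) fun z _ =>
      H.fadd _ _).le ?_ ?_ ?_
  · linarith
  · linarith
  · norm_num

theorem reconst (Q : Fin N ↪ Fin n) (d : ℕ) (a : Fin N → ZMod q) :
    CostLE (2 * G) (reconst W Q d a) (M ^ 2) (98 * M ^ 3 * G) 1 := by
  refine (Bounded.bind (CostLE.par H.quorum_le fun j => CostLE.par H.quorum_le fun i =>
    send W (H.bits_scalar W) _ _ _) fun m _ => CostLE.par H.quorum_le fun j =>
    Bounded.bind (H.decode _ _) fun r _ => CostLE.pure).le ?_ ?_ ?_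
  · linarith
  · linarith
  · norm_num

omit W

theorem shAdd (x y : Fin N → ZMod q) : CostLE B (shAdd x y : Proto n _) 0 (M * G) 0 :=
  CostLE.par H.quorum_le fun _ => H.fadd _ _
theorem shSub (x y : Fin N → ZMod q) : CostLE B (shSub x y : Proto n _) 0 (M * G) 0 :=
  CostLE.par H.quorum_le fun _ => H.fsub _ _
theorem shScale (c : ZMod q) (x : Fin N → ZMod q) :
    CostLE B (shScale c x : Proto n _) 0 (M * G) 0 :=
  CostLE.par H.quorum_le fun _ => H.fmul _ _
theorem shSum {k K : ℕ} (hk : k ≤ K) (x : Fin k → Fin N → ZMod q) :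
    CostLE B (shSum x : Proto n _) 0 (M * (K * G)) 0 :=
  CostLE.par H.quorum_le fun _ => H.fsum_ofFn hk _
theorem shXor (c : Fin N → Bool) (x : Fin N → ZMod q) :
    CostLE B (shXor c x : Proto n _) 0 (M * G) 0 :=
  CostLE.par H.quorum_le fun _ => Bounded.ite (H.fsub _ _) CostLE.pure_le

variable (W : World n q b)

theorem div_le (k : ℕ) : N / k ≤ M := (Nat.div_le_self _ _).trans H.quorum_le

theorem multiply (hq : 1 ≤ q.size) (Q : Fin N ↪ Fin n) (x y : Fin N → ZMod q) :
    CostLE (2 * G) (multiply W Q x y) (25 * M ^ 3) (408 * M ^ 3 * G) 10 := by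
  have h₀ := H.pow_le 2 (j := 3) (by norm_num)
  have h₁ := H.pow_mul_le 1 (j := 3) (by norm_num)
  refine (Bounded.bind (CostLE.par le_rfl fun _ => H.genRand W hq Q (H.div_le 6)) fun uv _ =>
    Bounded.bind (CostLE.par H.quorum_le fun i => H.fmul _ _) fun w _ =>
    Bounded.bind (CostLE.par le_rfl fun _ => H.renewShares W hq Q (H.div_le 3) _) fun r _ =>
    Bounded.bind (H.shAdd _ _) fun e _ => Bounded.bind (H.shAdd _ _) fun f _ =>
    Bounded.bind (CostLE.par le_rfl fun _ => H.reconst W Q _ _) fun o _ =>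
    CostLE.par H.quorum_le fun i =>
      Bounded.bind (H.fmul _ _) fun _ _ => Bounded.bind (H.fmul _ _) fun _ _ =>
      Bounded.bind (H.fmul _ _) fun _ _ => Bounded.bind (H.fadd _ _) fun _ _ =>
      Bounded.bind (H.fadd _ _) fun _ _ => H.fsub _ _).le ?_ ?_ ?_
  · linarith
  · linarith
  · norm_num

/-! ### Comparison of shared values -/

theorem randInv (hq : 1 ≤ q.size) (Q : Fin N ↪ Fin n) :
    CostLE (2 * G) (randInv W Q) (34 * M ^ 3) (570 * M ^ 3 * G) 15 := by
  have h₀ := H.pow_le 2 (j := 3) (by norm_num)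
  have h₁ := H.pow_mul_le 1 (j := 3) (by norm_num)
  refine (Bounded.bind (CostLE.par le_rfl fun _ => H.genRand W hq Q (H.div_le 3)) fun r _ =>
    Bounded.bind (H.multiply W hq Q _ _) fun m _ => Bounded.bind (H.reconst W Q _ _) fun o _ =>
    Bounded.bind (CostLE.par H.quorum_le fun j => Bounded.bind (H.finv _) fun _ _ =>
      H.fmul _ _) fun i _ => CostLE.pure).le ?_ ?_ ?_
  · linarith
  · linarith
  · norm_num

/-- The masked products are formed in parallel and the prefix products of the opened values are
local. Thus the rounds do not depend on `k`, while the costs are linear in `k + 1`. -/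
theorem powers (hq : 1 ≤ q.size) (Q : Fin N ↪ Fin n) (k : ℕ) (x : Fin N → ZMod q) :
    CostLE (2 * G) (powers W Q k x) ((k + 1) * (110 * M ^ 3)) ((k + 1) * (1894 * M ^ 3 * G))
      46 := by
  have h₀ := Nat.mul_le_mul_left k (H.pow_le 2 (j := 3) (by norm_num))
  have h₁ := Nat.mul_le_mul_left k (H.pow_mul_le 1 (j := 3) (by norm_num))
  refine (Bounded.bind (CostLE.par le_rfl fun _ => H.randInv W hq Q) fun r _ =>
    Bounded.bind (CostLE.par le_rfl fun j => Bounded.bind (H.multiply W hq Q _ _) fun u _ =>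
      Bounded.bind (H.multiply W hq Q _ _) fun v _ => H.reconst W Q _ _) fun e _ =>
    Bounded.bind (CostLE.par le_rfl fun j => H.multiply W hq Q _ _) fun m _ =>
    Bounded.bind (CostLE.par H.quorum_le fun i => H.fscan_ofFn _ _) fun s _ =>
    CostLE.par le_rfl fun j => CostLE.par H.quorum_le fun i => H.fmul _ _).le ?_ ?_ ?_
  · linarith [Nat.zero_le (M ^ 3)]
  · linarith [Nat.zero_le (M ^ 3 * G)]
  · norm_num

/-- All communication comes from `powers`. The quadratic term in the operations is the interpolation
on `k + 1` points that every member does locally. -/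
theorem disj (hq : 1 ≤ q.size) (Q : Fin N ↪ Fin n) {k : ℕ} (x : Fin k → Fin N → ZMod q) :
    CostLE (2 * G) (disj W Q x) ((k + 1) * (110 * M ^ 3))
      ((k + 1) * (1900 * M ^ 3 * G) + 20 * (k + 1) ^ 2 * M * G) 46 := by
  have h₁ := Nat.mul_le_mul_left (k + 1) (H.pow_mul_le 1 (j := 3) (by norm_num))
  have hint : ∀ f : Fin (k + 1) → ZMod q × ZMod q,
      CostLE (2 * G) (interpolate (List.ofFn f) : Proto n _) 0
        ((k + 1) * ((8 * (k + 1) + 12 * (k + 1)) * G)) 0 := fun f => by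
    refine (interpolate_bounded _).costLE.le le_rfl ?_ le_rfl
    rw [List.length_ofFn]
    exact Nat.mul_le_mul_left _ (Nat.mul_le_mul (by omega) H.field_le)
  refine (Bounded.bind (H.shSum le_rfl _) fun s _ => Bounded.bind (H.shAdd _ _) fun y _ =>
    Bounded.bind (H.powers W hq Q k _) fun pw _ => CostLE.par H.quorum_le fun i =>
    Bounded.bind (hint _) fun p _ => Bounded.bind (CostLE.par le_rfl fun j => H.fmul _ _)
    fun terms _ => Bounded.bind (H.fsum_ofFn le_rfl _) fun t _ => H.fadd _ _).le ?_ ?_ ?_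
  · linarith
  · linarith [Nat.zero_le (M ^ 3 * G), Nat.zero_le (M * G), Nat.zero_le (k * (M ^ 3 * G))]
  · norm_num

/-- With `s` the integer square root, `(s + 2) ^ 2 = s ^ 2 + 4 * s + 4`, where `s ^ 2` and `s` are
at most `q.size ≤ M`, and `4 ≤ 4 * M`. -/
theorem sqrt_block_le : (q.size.sqrt + 2) ^ 2 ≤ 9 * M := by
  have h₁ := Nat.sqrt_le' q.size
  have h₂ := Nat.sqrt_le_self q.size
  have h₃ := H.size_le
  have h₄ := H.one_le
  linarith

/-- Three batches of `k` disjunctions of `k` bits and two batches of `k ^ 2` multiplications: since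
`k ^ 2 = O(M)`, this costs only `M` times as much as one multiplication, up to a constant. -/
theorem prefixDisj (hq : 1 ≤ q.size) (Q : Fin N ↪ Fin n) (x : Fin q.size → Fin N → ZMod q) :
    CostLE (2 * G) (prefixDisj W Q x) (3420 * M ^ 4) (66000 * M ^ 4 * G) 158 := by
  unfold AnonBroadcast.prefixDisj
  extract_lets k z
  -- Here `k` is by definition the integer square root plus one.
  have hk : (k + 1) ^ 2 ≤ 9 * M := H.sqrt_block_le
  have hkk : k * (k + 1) ≤ 9 * M := by nlinarith
  have hk₂ : k * k ≤ 9 * M := by nlinarith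
  have hk₁ : k ≤ 9 * M := by nlinarith
  have h₁ := H.pow_mul_le 2 (j := 4) (by norm_num)
  have h₂ := H.pow_mul_le 3 (j := 4) (by norm_num)
  refine (Bounded.bind (CostLE.par le_rfl fun _ => H.disj W hq Q _) fun v _ =>
    Bounded.bind (CostLE.par le_rfl fun _ => H.disj W hq Q _) fun y _ =>
    Bounded.bind (CostLE.par le_rfl fun _ => H.shSub _ _) fun f _ =>
    Bounded.bind (CostLE.par le_rfl fun _ => CostLE.par le_rfl fun _ => H.multiply W hq Q _ _)
      fun g _ =>
    Bounded.bind (CostLE.par le_rfl fun _ => H.shSum le_rfl _) fun c _ =>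
    Bounded.bind (CostLE.par le_rfl fun _ => H.disj W hq Q _) fun e _ =>
    Bounded.bind (CostLE.par le_rfl fun _ => CostLE.par le_rfl fun _ =>
      Bounded.bind (H.multiply W hq Q _ _) fun m _ => Bounded.bind (H.shAdd _ _) fun a _ =>
      H.shSub _ _) fun s _ => CostLE.pure).le ?_ ?_ ?_
  · have e₁ := Nat.mul_le_mul_right (M ^ 3) hkk
    have e₂ := Nat.mul_le_mul_right (M ^ 3) hk₂
    linarith
  · have e₁ := Nat.mul_le_mul_right (M ^ 3 * G) hkk
    have e₂ := Nat.mul_le_mul_right (M ^ 3 * G) hk₂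
    -- The interpolations contribute `k * (k + 1) ^ 2 * M * G`; the crude `k ≤ 9 * M` already makes
    -- this `O(M ^ 3 * G)`.
    have e₃ := Nat.mul_le_mul_right (M * G) (Nat.mul_le_mul hk₁ hk)
    have e₄ := Nat.mul_le_mul_right (M * G) hk₂
    have e₅ := Nat.mul_le_mul_right (M * G) hk₁
    linarith [Nat.zero_le (M ^ 4 * G)]
  · norm_num

theorem firstDiff (hq : 1 ≤ q.size) (Q : Fin N ↪ Fin n) (c : Fin N → Fin q.size → Bool)
    (x : Fin q.size → Fin N → ZMod q) :
    CostLE (2 * G) (firstDiff W Q c x) (3420 * M ^ 4) (66002 * M ^ 4 * G) 158 := by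
  have h₁ := H.pow_mul_le 2 (j := 4) (by norm_num)
  refine (Bounded.bind (CostLE.par H.size_le fun _ => H.shXor _ _) fun e _ =>
    Bounded.bind (H.prefixDisj W hq Q _) fun f _ =>
    CostLE.par H.size_le fun _ => H.shSub _ _).le ?_ ?_ ?_
  · linarith
  · linarith
  · norm_num

theorem randBit (hq : 1 ≤ q.size) (Q : Fin N ↪ Fin n) :
    CostLE (2 * G) (randBit W Q) (30 * M ^ 3) (546 * M ^ 3 * G) 15 := by
  have h₀ := H.pow_le 2 (j := 3) (by norm_num)
  have h₁ := H.pow_mul_le 1 (j := 3) (by norm_num)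
  refine (Bounded.bind (H.genRand W hq Q (H.div_le 3)) fun x _ =>
    Bounded.bind (H.multiply W hq Q _ _) fun y _ => Bounded.bind (H.reconst W Q _ _) fun o _ =>
    CostLE.par H.quorum_le fun j => Bounded.bind (H.fsqrt _) fun _ _ =>
      Bounded.bind (H.finv _) fun _ _ => Bounded.bind (H.fmul _ _) fun _ _ =>
      Bounded.bind (H.fadd _ _) fun _ _ => Bounded.bind (H.finv _) fun _ _ =>
      H.fmul _ _).le ?_ ?_ ?_
  · linarith
  · linarith
  · norm_num

theorem randDigitsOnce (hq : 1 ≤ q.size) (Q : Fin N ↪ Fin n) :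
    CostLE (2 * G) (randDigitsOnce W Q) (3451 * M ^ 4) (66650 * M ^ 4 * G) 174 := by
  have h₀ := H.pow_le 2 (j := 4) (by norm_num)
  have h₁ := H.pow_mul_le 1 (j := 4) (by norm_num)
  have h₂ := H.pow_mul_le 2 (j := 4) (by norm_num)
  have h₃ := H.pow_mul_le 3 (j := 4) (by norm_num)
  refine (Bounded.bind (CostLE.par H.size_le fun _ => H.randBit W hq Q) fun x _ =>
    Bounded.bind (H.firstDiff W hq Q _ _) fun g _ =>
    Bounded.bind (H.shSum H.size_le _) fun s _ => Bounded.bind (H.reconst W Q _ _) fun o _ =>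
    Bounded.bind (CostLE.par H.quorum_le fun i => H.feq _ _) fun ok _ => CostLE.pure).le ?_ ?_ ?_
  · linarith
  · linarith [Nat.zero_le (M ^ 4 * G)]
  · norm_num

/-- The number of attempts is fixed, so the bound is a worst case and not an expectation; being
parallel, the attempts do not add rounds. -/
theorem randDigits (hq : 1 ≤ q.size) (Q : Fin N ↪ Fin n) :
    CostLE (2 * G) (randDigits W Q) (13804 * M ^ 4) (266600 * M ^ 4 * G) 174 := by
  refine (Bounded.bind (CostLE.par le_rfl fun _ => H.randDigitsOnce W hq Q) fun r _ =>
    CostLE.pure).le ?_ ?_ ?_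
  · linarith
  · linarith
  · norm_num

theorem lsb (hq : 1 ≤ q.size) (Q : Fin N ↪ Fin n) (x : Fin N → ZMod q) :
    CostLE (2 * G) (lsb W Q x) (17275 * M ^ 4) (333530 * M ^ 4 * G) 353 := by
  have h₀ := H.pow_le 2 (j := 4) (by norm_num)
  have h₀' := H.pow_le 3 (j := 4) (by norm_num)
  have h₁ := H.pow_mul_le 1 (j := 4) (by norm_num)
  have h₂ := H.pow_mul_le 2 (j := 4) (by norm_num)
  have h₃ := H.pow_mul_le 3 (j := 4) (by norm_num)
  refine (Bounded.bind (H.randDigits W hq Q) fun dig _ =>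
    Bounded.bind (CostLE.par H.size_le fun _ => H.shScale _ _) fun terms _ =>
    Bounded.bind (H.shSum H.size_le _) fun r _ => Bounded.bind (H.shAdd _ _) fun y _ =>
    Bounded.bind (H.reconst W Q _ _) fun o _ =>
    Bounded.bind (CostLE.par H.quorum_le fun _ => CostLE.par H.size_le fun _ => H.fbit _ _)
      fun c _ =>
    Bounded.bind (CostLE.par H.quorum_le fun _ => H.fbit _ _) fun c₀ _ =>
    Bounded.bind (H.firstDiff W hq Q _ _) fun g _ =>
    Bounded.bind (CostLE.par H.size_le fun _ => H.multiply W hq Q _ _) fun h _ =>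
    Bounded.bind (H.shSum H.size_le _) fun f _ => Bounded.bind (H.shXor _ _) fun e _ =>
    Bounded.bind (H.multiply W hq Q _ _) fun m _ => Bounded.bind (H.shAdd _ _) fun s _ =>
    Bounded.bind (H.shScale _ _) fun m₂ _ => H.shSub _ _).le ?_ ?_ ?_
  · linarith
  · linarith [Nat.zero_le (M ^ 4 * G)]
  · norm_num

theorem less (hq : 1 ≤ q.size) (Q : Fin N ↪ Fin n) (x y : Fin N → ZMod q) :
    CostLE (2 * G) (less W Q x y) (51875 * M ^ 4) (1001500 * M ^ 4 * G) 373 := by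
  have h₀ := H.pow_le 3 (j := 4) (by norm_num)
  have h₁ := H.pow_mul_le 1 (j := 4) (by norm_num)
  have h₃ := H.pow_mul_le 3 (j := 4) (by norm_num)
  refine (Bounded.bind (H.shSub _ _) fun z _ => Bounded.bind (CostLE.par le_rfl fun _ =>
      Bounded.bind (H.shScale _ _) fun d _ => Bounded.bind (H.lsb W hq Q _) fun l _ =>
      H.shSub _ _) fun t _ =>
    Bounded.bind (H.multiply W hq Q _ _) fun m _ => Bounded.bind (H.shAdd _ _) fun s _ =>
    Bounded.bind (H.shScale _ _) fun m₂ _ => Bounded.bind (H.shSub _ _) fun u _ =>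
    Bounded.bind (H.multiply W hq Q _ _) fun v _ => Bounded.bind (H.shAdd _ _) fun a₁ _ =>
    Bounded.bind (H.shAdd _ _) fun a₂ _ => H.shSub _ _).le ?_ ?_ ?_
  · linarith
  · linarith [Nat.zero_le (M ^ 4 * G)]
  · norm_num

theorem compare (hq : 1 ≤ q.size) (Q : Fin N ↪ Fin n) (x y : Fin N → ZMod q) :
    CostLE (2 * G) (compare W Q x y) (51875 * M ^ 4) (1001501 * M ^ 4 * G) 373 := by
  have h₁ := H.pow_mul_le 1 (j := 4) (by norm_num)
  refine (Bounded.bind (H.less W hq Q _ _) fun l _ => H.shSub _ _).le ?_ ?_ ?_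
  · linarith
  · linarith
  · norm_num

/-! ### Gates and resharing -/

theorem reshare (hq : 1 ≤ q.size) (Q Q' : Fin N ↪ Fin n) (x : Fin N → ZMod q) :
    CostLE (2 * G) (reshare W Q Q' x) (6 * M ^ 3) (47 * M ^ 3 * G) 6 := by
  have h₀ := H.pow_le 1 (j := 3) (by norm_num)
  refine (Bounded.bind (H.renewShares W hq Q (H.div_le 3) _) fun y _ =>
    CostLE.par H.quorum_le fun i => send W (H.bits_scalar W) _ _ _).le ?_ ?_ ?_
  · linarith
  · linarith
  · norm_num

theorem gate (hq : 1 ≤ q.size) (Q Q₁ Q₂ : Fin N ↪ Fin n) (u v : Pair N q) :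
    CostLE (2 * G) (gate W Q Q₁ Q₂ u v) (52100 * M ^ 4) (1005000 * M ^ 4 * G) 389 := by
  have h₀ := H.pow_le 3 (j := 4) (by norm_num)
  have h₁ := H.pow_mul_le 1 (j := 4) (by norm_num)
  have h₃ := H.pow_mul_le 3 (j := 4) (by norm_num)
  refine (Bounded.bind (H.compare W hq Q _ _) fun _ _ => Bounded.bind (H.shSub _ _) fun _ _ =>
    Bounded.bind (CostLE.par le_rfl fun _ => H.multiply W hq Q _ _) fun _ _ =>
    Bounded.bind (CostLE.par le_rfl fun _ => H.shAdd _ _) fun _ _ =>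
    Bounded.bind (CostLE.par le_rfl fun _ => H.reshare W hq Q _ _) fun _ _ =>
    CostLE.pure).le ?_ ?_ ?_
  · linarith [Nat.zero_le (M ^ 4)]
  · linarith [Nat.zero_le (M ^ 4 * G)]
  · norm_num

end SizeBounds

/-! ## Costs of the circuit evaluation and of the protocol -/

theorem length_numberGates {n : ℕ} : ∀ (k : ℕ) (Ls : List (List (Fin n × Fin n))),
    (numberGates k Ls).length = Ls.length
  | _, [] => rfl
  | k, L :: Ls => congrArg (· + 1) (length_numberGates (k + L.length) Ls)

theorem length_le_of_mem_numberGates {n : ℕ} : ∀ (k : ℕ) (Ls : List (List (Fin n × Fin n))),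
    (∀ L ∈ Ls, L.length ≤ n) → ∀ L ∈ numberGates k Ls, L.length ≤ n
  | _, [], _, _, h => absurd h List.not_mem_nil
  | k, L :: Ls, hLs, L', h => by
    rcases List.mem_cons.1 h with rfl | h
    · simpa using hLs L List.mem_cons_self
    · exact length_le_of_mem_numberGates _ Ls (fun L hL => hLs L (List.mem_cons_of_mem _ hL)) L' h

/-- The comparators of a level act on disjoint pairs of wires, so that there are at most `n`. -/
theorem ComparatorNetwork.length_level_le {n : ℕ} (C : ComparatorNetwork n)
    {L : List (Fin n × Fin n)} (hL : L ∈ C.levels) : L.length ≤ n := by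
  have h := (C.disjoint L hL).length_le_card
  have hlen : (L.flatMap fun g => [g.1, g.2]).length = L.length * 2 := by
    simp [List.length_flatMap]
  rw [hlen, Fintype.card_fin] at h
  omega

namespace SizeBounds

variable {n q b N M G : ℕ} (H : SizeBounds q b N M G) (W : World n q b)
include H

theorem evalLevels (hq : 1 ≤ q.size) (Q : Fin n → Fin N ↪ Fin n) :
    ∀ (Ls : List (List (Gate n))), (∀ L ∈ Ls, L.length ≤ n) → ∀ st : Fin n → Pair N q,
    CostLE (2 * G) (evalLevels W Q Ls st) (Ls.length * (n * (52100 * M ^ 4)))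
      (Ls.length * (n * (1005000 * M ^ 4 * G))) (Ls.length * 389)
  | [], _, _ => CostLE.pure_le
  | L :: rest, hLs, st => by
    have hL := hLs L List.mem_cons_self
    refine (Bounded.bind (CostLE.parList (fun g => H.gate W hq _ _ _ _ _) L) fun outs _ =>
      evalLevels hq Q rest (fun L hL => hLs L (List.mem_cons_of_mem _ hL)) _).le ?_ ?_ ?_
    · have := Nat.mul_le_mul_right (52100 * M ^ 4) hL
      rw [List.length_cons]; linarith
    · have := Nat.mul_le_mul_right (1005000 * M ^ 4 * G) hL
      rw [List.length_cons]; linarith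
    · rw [List.length_cons]; linarith

theorem shuffle (hq : 1 ≤ q.size) (C : ComparatorNetwork n) (hC : C.depth ≤ M)
    (Q : Fin n → Fin N ↪ Fin n) (x : Fin n → ZMod q) :
    CostLE (2 * G) (shuffle W C Q x) (52108 * (n * M ^ 5)) (1005060 * (n * (M ^ 5 * G)))
      (397 * M) := by
  have h₁ := Nat.mul_le_mul_left n (H.pow_le 2 (j := 5) (by norm_num))
  have h₂ := Nat.mul_le_mul_left n (H.pow_le 3 (j := 5) (by norm_num))
  have h₃ := Nat.mul_le_mul_left n (H.pow_mul_le 2 (j := 5) (by norm_num))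
  have h₄ := Nat.mul_le_mul_left n (H.pow_mul_le 3 (j := 5) (by norm_num))
  have hM := H.one_le
  have hev := H.evalLevels W hq Q (numberGates 0 C.levels)
    (length_le_of_mem_numberGates 0 C.levels fun L hL => C.length_level_le hL)
  rw [length_numberGates] at hev
  change C.levels.length ≤ M at hC
  refine (Bounded.bind (CostLE.par le_rfl fun i => H.shareSecret W hq _ (H.div_le 3) _ _)
    fun xs _ => Bounded.bind (CostLE.par le_rfl fun i => H.genRand W hq _ (H.div_le 3)) fun rs _ =>
    hev _).le ?_ ?_ ?_
  · have := Nat.mul_le_mul_right (n * (52100 * M ^ 4)) hC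
    linarith
  · have := Nat.mul_le_mul_right (n * (1005000 * M ^ 4 * G)) hC
    linarith
  · linarith

theorem majority {B : ℕ} (f : Fin N → ZMod q × ZMod q) :
    CostLE B (majority (List.ofFn f) : Proto n _) 0 (2 * M ^ 2 * G) 0 := by
  refine CostLE.tick.le le_rfl ?_ le_rfl
  rw [List.length_ofFn]
  have := Nat.mul_le_mul (Nat.pow_le_pow_left H.quorum_le 2) H.field_le
  linarith

/-- The bounds on messages and operations are quadratic in `n`; the final result uses only the two
rounds and the length of the messages. -/
theorem propagate (Q : Fin n → Fin N ↪ Fin n) (st : Fin n → Pair N q) :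
    CostLE (2 * G) (propagate W Q st) (n * (2 * M ^ 2 + n * M))
      (n * (196 * M ^ 3 * G + n * (2 * M ^ 2 * G))) 2 := by
  have hn : (n + 1) / 2 ≤ n := by omega
  refine (Bounded.bind (CostLE.par hn fun k =>
    Bounded.bind (CostLE.par le_rfl fun e => H.reconst W _ _ _) fun z _ =>
    CostLE.par le_rfl fun p => CostLE.par H.quorum_le fun i => send W (H.bits_pair W) _ _ _)
    fun o _ => CostLE.par le_rfl fun p => Bounded.bind
      (CostLE.par hn fun k => H.majority _) fun m _ => CostLE.pure).le ?_ ?_ ?_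
  · linarith
  · linarith
  · norm_num

theorem anonymousBroadcast (hq : 1 ≤ q.size) (C : ComparatorNetwork n) (hC : C.depth ≤ M)
    (Q : Fin n → Fin N ↪ Fin n) (x : Fin n → ZMod q) :
    CostLE (2 * G) (anonymousBroadcast W C Q x)
      (52108 * (n * M ^ 5) + n * (2 * M ^ 2 + n * M))
      (1005060 * (n * (M ^ 5 * G)) + n * (196 * M ^ 3 * G + n * (2 * M ^ 2 * G))) (399 * M) := by
  have hM := H.one_le
  exact (Bounded.bind (H.shuffle W hq C hC Q x) fun st _ => H.propagate W Q st).le le_rfl le_rfl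
    (by linarith)

end SizeBounds

/-- The binary length of a number that is polynomial in `n` is logarithmic in `n`. -/
theorem size_le_mul_log {c : ℝ} {n q : ℕ} (hn : 2 ≤ n) (hq : 0 < q)
    (h : (q : ℝ) ≤ c * (n : ℝ) ^ 3) : (q.size : ℝ) ≤ (8 + 4 * |Real.log c|) * Real.log n := by
  have hn' : (2 : ℝ) ≤ n := by exact_mod_cast hn
  have hq' : (0 : ℝ) < q := by exact_mod_cast hq
  -- A positive `q` below `c * n ^ 3` forces `c` to be positive, so its logarithm is meaningful.
  have hc : 0 < c := pos_of_mul_pos_left (hq'.trans_le h) (by positivity)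
  have hl2 : 1 / 2 ≤ Real.log 2 := by linarith [Real.log_two_gt_d9]
  have hL : 1 / 2 ≤ Real.log n := hl2.trans (Real.log_le_log (by norm_num) hn')
  have hsize : 0 < q.size := Nat.size_pos.2 hq
  obtain ⟨s, hs⟩ : ∃ s, q.size = s + 1 := ⟨q.size - 1, by omega⟩
  have hpow : (2 : ℝ) ^ s ≤ c * (n : ℝ) ^ 3 := by
    refine le_trans ?_ h
    exact_mod_cast Nat.lt_size.1 (by omega : s < q.size)
  have hlog := Real.log_le_log (by positivity) hpow
  rw [Real.log_pow, Real.log_mul hc.ne' (by positivity), Real.log_pow] at hlog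
  have habs := le_abs_self (Real.log c)
  -- From `2 ^ s ≤ c * n ^ 3` and `log 2 ≥ 1 / 2` one gets `s ≤ 2 * |log c| + 6 * log n`. Since `1 ≤
  -- 2 * log n`, the first term is at most `4 * |log c| * log n`, and the missing digit `s + 1`
  -- costs another `2 * log n`.
  have h₁ : (s : ℝ) * (1 / 2) ≤ s * Real.log 2 := by gcongr
  have h₂ : |Real.log c| * (1 / 2) ≤ |Real.log c| * Real.log n := by gcongr
  rw [hs]
  push_cast at hlog ⊢
  linarith

end AnonBroadcast

/-! ### Passage to the asymptotic bounds -/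

theorem mainTheorem3 (cN cD cq cG : ℝ) :
    ∃ K : ℝ, ∀ (n κ q b N : ℕ), 2 ≤ n → q.Prime →
    (q : ℝ) ≤ cq * (n : ℝ) ^ 3 → (N : ℝ) ≤ cN * Real.log n → (b : ℝ) ≤ cG * κ →
    ∀ (W : AnonBroadcast.World n q b) (Q : Fin n → Fin N ↪ Fin n)
      (C : AnonBroadcast.ComparatorNetwork n) (x : Fin n → ZMod q),
    (C.depth : ℝ) ≤ cD * Real.log n →
    -- messages and operations of the shuffle; length of messages and rounds of the whole protocol
    (((AnonBroadcast.shuffle W C Q x 0).trace.msgs.length : ℝ) ≤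
      K * (n * Real.log n ^ 5)) ∧
    (((AnonBroadcast.shuffle W C Q x 0).trace.ops : ℝ) ≤
      K * (n * (κ + Real.log n) * Real.log n ^ 5)) ∧
    (∀ m ∈ (AnonBroadcast.anonymousBroadcast W C Q x 0).trace.msgs,
      (m.bits : ℝ) ≤ K * (κ + Real.log n)) ∧
    (((AnonBroadcast.anonymousBroadcast W C Q x 0).trace.rounds : ℝ) ≤ K * Real.log n) := by
  -- One constant dominating all the given ones; absolute values are needed because their signs are
  -- unknown.
  set A : ℝ := 8 + 4 * |Real.log cq| + |cN| + |cD| + |cG| with hA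
  have hA1 : 1 ≤ A := by
    have := abs_nonneg (Real.log cq)
    have := abs_nonneg cN
    have := abs_nonneg cD
    have := abs_nonneg cG
    linarith
  have hApow : ∀ i ≤ 6, A ^ i ≤ A ^ 6 := fun i hi => pow_le_pow_right₀ hA1 hi
  -- Five factors `A` come from `M ^ 5` and one from `G`; the number is any bound for the largest
  -- coefficient, `1005060`.
  refine ⟨2000000 * A ^ 6, fun n κ q b N hn hq hqn hN hb W Q C x hC => ?_⟩
  have hL : 0 < Real.log n := Real.log_pos (by exact_mod_cast hn)
  have hs := AnonBroadcast.size_le_mul_log hn hq.pos hqn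
  have hq1 : 1 ≤ q.size := Nat.size_pos.2 hq.pos
  set L : ℝ := Real.log n
  set M : ℕ := max (max N q.size) C.depth with hM
  have hscale : ∀ c : ℝ, c ≤ A → c * L ≤ A * L := fun c hc => by gcongr
  have a₁ := abs_nonneg (Real.log cq)
  have a₂ := abs_nonneg cN
  have a₃ := abs_nonneg cD
  have a₄ := abs_nonneg cG
  have hs' : (q.size : ℝ) ≤ A * L := hs.trans (hscale _ (by linarith))
  have hML : (M : ℝ) ≤ A * L := by
    rw [hM]
    push_cast
    refine max_le (max_le (hN.trans (hscale _ ?_)) hs') (hC.trans (hscale _ ?_))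
    · linarith [le_abs_self cN]
    · linarith [le_abs_self cD]
  have hGL : ((b + q.size : ℕ) : ℝ) ≤ A * (κ + L) := by
    have : cG * κ ≤ A * κ := by
      gcongr
      linarith [le_abs_self cG]
    push_cast
    linarith
  have H : AnonBroadcast.SizeBounds q b N M (b + q.size) :=
    ⟨hq1.trans (le_max_of_le_left (le_max_right _ _)), le_max_of_le_left (le_max_left _ _),
      le_max_of_le_left (le_max_right _ _), le_rfl⟩
  set G : ℕ := b + q.size
  obtain ⟨h₁, h₂, -⟩ := H.shuffle W hq1 C (le_max_right _ _) Q x 0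
  obtain ⟨-, -, h₃, h₄, -⟩ := H.anonymousBroadcast W hq1 C (le_max_right _ _) Q x 0
  refine ⟨?_, ?_, fun μ hμ => ?_, ?_⟩
  · calc _ ≤ ((52108 * (n * M ^ 5) : ℕ) : ℝ) := by exact_mod_cast h₁
      _ = 52108 * (n * (M : ℝ) ^ 5) := by push_cast; ring
      _ ≤ 52108 * (n * (A * L) ^ 5) := by gcongr
      _ = 52108 * A ^ 5 * (n * L ^ 5) := by ring
      _ ≤ 2000000 * A ^ 6 * (n * L ^ 5) := by
        gcongr
        · norm_num
        · norm_num
  · calc _ ≤ ((1005060 * (n * (M ^ 5 * G)) : ℕ) : ℝ) := by exact_mod_cast h₂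
      _ = 1005060 * (n * ((M : ℝ) ^ 5 * G)) := by push_cast; ring
      _ ≤ 1005060 * (n * ((A * L) ^ 5 * (A * (κ + L)))) := by gcongr
      _ = 1005060 * A ^ 6 * (n * (κ + L) * L ^ 5) := by ring
      _ ≤ 2000000 * A ^ 6 * (n * (κ + L) * L ^ 5) := by
        gcongr
        norm_num
  · calc (μ.bits : ℝ) ≤ ((2 * G : ℕ) : ℝ) := by exact_mod_cast h₄ μ hμ
      _ = 2 * (G : ℝ) := by push_cast; ring
      _ ≤ 2 * (A * (κ + L)) := by gcongr
      -- The explicit exponent lets `gcongr` compare the powers of `A`, using `1 ≤ A`.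
      _ = 2 * A ^ 1 * (κ + L) := by ring
      _ ≤ 2000000 * A ^ 6 * (κ + L) := by
        gcongr
        · norm_num
        · norm_num
  · calc _ ≤ ((399 * M : ℕ) : ℝ) := by exact_mod_cast h₃
      _ = 399 * (M : ℝ) := by push_cast; ring
      _ ≤ 399 * (A * L) := by gcongr
      _ = 399 * A ^ 1 * L := by ring
      _ ≤ 2000000 * A ^ 6 * L := by
        gcongr
        · norm_num
        · norm_num
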